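/- Let \[ \mathcal R(s)=\int_{0\swarrow1}\frac{x^{-s}e^{\pi i x^2}}{e^{\pi i x}-e^{-\pi i x}}\,dx \] be Riemann's auxiliary function. Here $0\swarrow1$ is the straight line of direction $e^{\pi i/4}$ that crosses the real axis between $0$ and $1$, traversed from the upper right to the lower left, and $x^{-s}$ is the principal branch. Let $\gamma$ be Euler's constant and $\zeta$ the Riemann zeta function. For every fixed real $\sigma\ge0$, as $T\to+\infty$, the weighted mean \[ \frac1T\int_1^T|\mathcal R(\sigma+it)|^2\Bigl(\frac{t}{2\pi}\Bigr)^{\sigma}\,dt \] is equal to \[ \begin{cases} \frac{2}{3(1-2\sigma)}\left(\frac{T}{2\pi}\right)^{1/2}+O(T^{1/4}) & \text{if } 0\le\sigma\le\frac14,\\ \frac{2}{3(1-2\sigma)}\left(\frac{T}{2\pi}\right)^{1/2}+\frac{\zeta(2\sigma)}{\sigma+1}\left(\frac{T}{2\pi}\right)^{\sigma}+O(T^{1/4}) & \text{if } \frac14<\sigma<\frac12,\\ \frac13\left(\frac{T}{2\pi}\right)^{1/2}\log\frac{T}{2\pi}+2\,\frac{3\gamma-1}{9}\left(\frac{T}{2\pi}\right)^{1/2}+O(T^{1/4}\sqrt{\log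 T}) & \text{if } \sigma=\frac12,\\ \frac{\zeta(2\sigma)}{\sigma+1}\left(\frac{T}{2\pi}\right)^{\sigma}+\frac{2}{3(1-2\sigma)}\left(\frac{T}{2\pi}\right)^{1/2}+O(T^{\sigma/2}) & \text{if } \frac12<\sigma<1,\\ \frac{\zeta(2\sigma)}{\sigma+1}\left(\frac{T}{2\pi}\right)^{\sigma}+O(T^{\sigma/2}) & \text{if } 1\le\sigma\le2,\\ \frac{\zeta(2\sigma)}{\sigma+1}\left(\frac{T}{2\pi}\right)^{\sigma}+O(T^{\sigma-1}) & \text{if } \sigma>2, \end{cases} \] where the implicit constants depend on $\sigma$ but not on $T$. -/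

import Mathlib

open Complex Filter Asymptotics MeasureTheory

/-- The direction `e^{πi/4}` of the line of integration. -/
noncomputable def siegelDir : ℂ := Complex.exp (Real.pi * I / 4)

/-- The integrand `x^{-s} e^{πi x²} / (e^{πi x} - e^{-πi x})`, with the principal branch of `x^{-s}`.
The line of integration below does not meet the cut `(-∞, 0]`, nor any integer. -/
noncomputable def siegelIntegrand (s x : ℂ) : ℂ :=
  x ^ (-s) * Complex.exp (Real.pi * I * x ^ 2) /
    (Complex.exp (Real.pi * I * x) - Complex.exp (-(Real.pi * I * x)))

/-- Riemann's auxiliary function `R(s) = ∫_{0↙1} x^{-s} e^{πi x²} / (e^{πi x} - e^{-πi x}) dx`.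
The path `0↙1` is the line of direction `e^{πi/4}` that crosses the real axis between `0` and `1`
(here at `1/2`), run from the upper right to the lower left: `x = 1/2 + u e^{πi/4}` with `u` going
from `+∞` to `-∞`, whence the sign. -/
noncomputable def siegelR (s : ℂ) : ℂ :=
  -∫ u : ℝ, siegelIntegrand s (1 / 2 + u * siegelDir) * siegelDir

/-- The weighted mean `(1/T) ∫_1^T |R(σ+it)|² (t/2π)^σ dt`. -/
noncomputable def weightedMean (σ T : ℝ) : ℝ :=
  (1 / T) * ∫ t in (1 : ℝ)..T, ‖siegelR (σ + t * I)‖ ^ 2 * (t / (2 * Real.pi)) ^ σ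

/-! Write a = √(t/2π), the saddle point of x^{-it} e^{πi x²}. The line of integration is moved to
the right to the half-integer b = ⌊a⌋ + 1/2. Each integer n that is crossed contributes the residue
n^{-s} (`siegelLine_succ`). On the new line the denominator is at least 2 in modulus and the
numerator is at most a constant times a^{-σ} times a Gaussian of fixed width (`saddle_exponent_le`).
Hence R(s) is the sum of n^{-s} over n ≤ a, up to O(a^{-σ})
(`exists_norm_siegelR_sub_siegelSum_le`).

The weight (t/2π)^σ = a^{2σ} turns the square of that error into O(1). The squared main sum splits
into a diagonal and an off-diagonal part. Off the diagonal, the first derivative test bounds each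
oscillating integral by the inverse of log(n/m), and the double sum over m < n is bounded by a power
of T (`exists_abs_integral_norm_siegelSum_sq_sub_le`). On the diagonal, the expansion of the partial
sums of n^{-2σ} gives ζ(2σ) u^σ + u^{1/2}/(1-2σ) + O(1) with u = t/2π, or a logarithm and γ at σ =
1/2. Averaging these powers of u produces the main terms.

Passing from the main sum to R costs a cross term of the order of the square root of the main term.
It is handled pointwise by 2|w|d ≤ |w|²/l + l d² with l = l(T) of that order
(`isBigO_weightedMean_sub`). The error terms T^{1/4}, T^{1/4}√log T and T^{σ/2} are such square
roots; for σ > 2 the off-diagonal bound T^{σ-1} is larger and takes over. -/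

/-! ### Residue calculus in a horizontal strip. -/

/-- The boundary integral of `1 / z` over a centred rectangle: horizontal sides. -/
lemma integral_inv_add_mul_I (L y : ℝ) (hy : y ≠ 0) :
    ∫ x : ℝ in -L..L, ((x : ℂ) + y * I)⁻¹ = -(2 * Real.arctan (L / y)) * I := by
  have h1 : ∀ x ∈ Set.uIcc (-L) L, HasDerivAt
      (fun x : ℝ => ((Real.log (x ^ 2 + y ^ 2) / 2 : ℝ) : ℂ) - (Real.arctan (x / y) : ℝ) * I)
      (((x : ℂ) + y * I)⁻¹) x := by
    intro x _
    have hp : 0 < x ^ 2 + y ^ 2 := by positivity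
    have e1 : HasDerivAt (fun x : ℝ => Real.log (x ^ 2 + y ^ 2) / 2) (x / (x ^ 2 + y ^ 2)) x := by
      have := (((hasDerivAt_pow 2 x).add_const (y ^ 2)).log hp.ne').div_const 2
      refine this.congr_deriv ?_
      push_cast
      field_simp
    have e2 : HasDerivAt (fun x : ℝ => Real.arctan (x / y)) (y / (x ^ 2 + y ^ 2)) x := by
      have := ((hasDerivAt_id x).div_const y).arctan
      refine this.congr_deriv ?_
      have : 1 + (x / y) ^ 2 ≠ 0 := by positivity
      simp only [id]
      field_simp
      ring
    refine (e1.ofReal_comp.sub (e2.ofReal_comp.mul_const I)).congr_deriv ?_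
    have hz : (x : ℂ) + y * I ≠ 0 := by
      intro h
      have := congrArg Complex.im h
      simp at this
      exact hy this
    have hp' : (x : ℂ) ^ 2 + (y : ℂ) ^ 2 ≠ 0 := by exact_mod_cast hp.ne'
    push_cast
    field_simp
    ring_nf
    simp only [I_sq]
    ring
  rw [intervalIntegral.integral_eq_sub_of_hasDerivAt h1]
  · rw [neg_div, Real.arctan_neg]
    push_cast
    ring_nf
  · apply ContinuousOn.intervalIntegrable
    apply ContinuousOn.inv₀ (by fun_prop)
    intro x _ h
    have := congrArg Complex.im h
    simp at this
    exact hy this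

/-- Residue computation in a horizontal strip: the difference of the integrals of `G z / z` over the
lines `Im z = -y₀` and `Im z = y₀`. -/
lemma integral_strip_sub_eq {G : ℂ → ℂ} {U : Set ℂ} {y₀ : ℝ} {B : ℝ → ℝ} (hy₀ : 0 < y₀)
    (hU : IsOpen U) (hsub : ∀ z : ℂ, |z.im| ≤ y₀ → z ∈ U) (hG : DifferentiableOn ℂ G U)
    (hint : Integrable fun u : ℝ => G (u + y₀ * I) / (u + y₀ * I))
    (hint' : Integrable fun u : ℝ => G (u + (-y₀ : ℝ) * I) / (u + (-y₀ : ℝ) * I))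
    (hB : Tendsto B atTop (nhds 0))
    (hbound : ∀ L : ℝ, 1 ≤ L → ∀ y : ℝ, |y| ≤ y₀ →
      ‖G (L + y * I) / (L + y * I)‖ ≤ B L ∧ ‖G ((-L : ℝ) + y * I) / ((-L : ℝ) + y * I)‖ ≤ B L) :
    (∫ u : ℝ, G (u + (-y₀ : ℝ) * I) / (u + (-y₀ : ℝ) * I)) -
      ∫ u : ℝ, G (u + y₀ * I) / (u + y₀ * I) = 2 * Real.pi * I * G 0 := by
  set F : ℂ → ℂ := fun z => G z / z with hF
  have h0 : U ∈ nhds (0 : ℂ) := hU.mem_nhds (hsub 0 (by simpa using hy₀.le))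
  -- The pole is subtracted: `dslope G 0` is (G z - G 0)/z continued through 0, so Cauchy's theorem
  -- applies to it, and the pole survives only in the explicit integral of 1/z.
  have hH : DifferentiableOn ℂ (dslope G 0) U := (Complex.differentiableOn_dslope h0).2 hG
  have hHF : ∀ z : ℂ, z ≠ 0 → dslope G 0 z = F z - G 0 * z⁻¹ := by
    intro z hz
    rw [dslope_of_ne _ hz, slope_def_field]
    simp only [hF]
    field_simp
    ring
  have hsideR : ∀ L : ℝ, 0 < L → ∀ y : ℝ, ((L : ℂ) + y * I) ≠ 0 := by
    intro L hL y h
    have := congrArg Complex.re h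
    simp at this
    exact hL.ne' this
  have hsideL : ∀ L : ℝ, 0 < L → ∀ y : ℝ, (((-L : ℝ) : ℂ) + y * I) ≠ 0 := by
    intro L hL y h
    have := congrArg Complex.re h
    simp at this
    exact hL.ne' this
  have hline : ∀ y : ℝ, y ≠ 0 → ∀ x : ℝ, ((x : ℂ) + y * I) ≠ 0 := by
    intro y hy x h
    have := congrArg Complex.im h
    simp at this
    exact hy this
  -- the horizontal pieces
  have hhor : ∀ y : ℝ, y ≠ 0 → |y| ≤ y₀ → ∀ L : ℝ,
      ∫ x : ℝ in -L..L, dslope G 0 (x + y * I) =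
        (∫ x : ℝ in -L..L, F (x + y * I)) + 2 * G 0 * Real.arctan (L / y) * I := by
    intro y hy hyy L
    have hc : Continuous fun x : ℝ => dslope G 0 (x + y * I) := by
      refine hH.continuousOn.comp_continuous (by fun_prop) fun x => hsub _ ?_
      simpa using hyy
    have hi : Continuous fun x : ℝ => ((x : ℂ) + y * I)⁻¹ :=
      Continuous.inv₀ (by fun_prop) (hline y hy)
    have e : ∀ x : ℝ, F (x + y * I) = dslope G 0 (x + y * I) + G 0 * ((x : ℂ) + y * I)⁻¹ := by
      intro x
      rw [hHF _ (hline y hy x)]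
      ring
    simp_rw [e]
    rw [intervalIntegral.integral_add (hc.intervalIntegrable _ _)
      ((hi.intervalIntegrable _ _).const_mul _), intervalIntegral.integral_const_mul,
      integral_inv_add_mul_I L y hy]
    ring
  -- the vertical pieces
  have hbd : ∀ L : ℝ, 1 ≤ L → ∀ y : ℝ, |y| ≤ y₀ →
      ‖dslope G 0 (L + y * I)‖ ≤ B L + ‖G 0‖ / L ∧
      ‖dslope G 0 ((-L : ℝ) + y * I)‖ ≤ B L + ‖G 0‖ / L := by
    intro L hL y hy
    have hL0 : 0 < L := by linarith
    obtain ⟨b1, b2⟩ := hbound L hL y hy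
    have n1 : L ≤ ‖(L : ℂ) + y * I‖ := by
      refine le_trans ?_ (Complex.abs_re_le_norm _)
      simp [le_abs_self]
    have n2 : L ≤ ‖((-L : ℝ) : ℂ) + y * I‖ := by
      refine le_trans ?_ (Complex.abs_re_le_norm _)
      simp [le_abs_self]
    constructor
    · rw [hHF _ (hsideR L hL0 y)]
      refine (norm_sub_le _ _).trans (add_le_add b1 ?_)
      rw [norm_mul, norm_inv, div_eq_mul_inv]
      gcongr
    · rw [hHF _ (hsideL L hL0 y)]
      refine (norm_sub_le _ _).trans (add_le_add b2 ?_)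
      rw [norm_mul, norm_inv, div_eq_mul_inv]
      gcongr
  have hB2 : Tendsto (fun L : ℝ => (B L + ‖G 0‖ / L) * |y₀ - -y₀|) atTop (nhds 0) := by
    have := (hB.add (tendsto_const_nhds.div_atTop tendsto_id : Tendsto (fun L : ℝ => ‖G 0‖ / id L)
      atTop (nhds 0))).mul_const |y₀ - -y₀|
    simpa using this
  have hvR : Tendsto (fun L : ℝ => ∫ y : ℝ in -y₀..y₀, dslope G 0 (L + y * I)) atTop (nhds 0) := by
    refine squeeze_zero_norm' ?_ hB2
    filter_upwards [eventually_ge_atTop 1] with L hL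
    refine intervalIntegral.norm_integral_le_of_norm_le_const fun y hy => (hbd L hL y ?_).1
    rw [Set.uIoc_of_le (by linarith)] at hy
    exact abs_le.2 ⟨hy.1.le, hy.2⟩
  have hvL : Tendsto (fun L : ℝ => ∫ y : ℝ in -y₀..y₀, dslope G 0 ((-L : ℝ) + y * I)) atTop
      (nhds 0) := by
    refine squeeze_zero_norm' ?_ hB2
    filter_upwards [eventually_ge_atTop 1] with L hL
    refine intervalIntegral.norm_integral_le_of_norm_le_const fun y hy => (hbd L hL y ?_).2
    rw [Set.uIoc_of_le (by linarith)] at hy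
    exact abs_le.2 ⟨hy.1.le, hy.2⟩
  -- Cauchy's theorem on the rectangle. The two arctangents of 1/z add up to the factor 4, and
  -- arctan(L/y₀) → π/2 turns it into 2πi G(0).
  have hrect : ∀ L : ℝ, (∫ x : ℝ in -L..L, F (x + (-y₀ : ℝ) * I)) - (∫ x : ℝ in -L..L, F (x + y₀ * I))
      - 4 * G 0 * Real.arctan (L / y₀) * I
      + I * (∫ y : ℝ in -y₀..y₀, dslope G 0 (L + y * I))
      - I * (∫ y : ℝ in -y₀..y₀, dslope G 0 ((-L : ℝ) + y * I)) = 0 := by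
    intro L
    have := Complex.integral_boundary_rect_eq_zero_of_differentiableOn (dslope G 0)
      ((-L : ℝ) + (-y₀ : ℝ) * I) (L + y₀ * I) (hH.mono ?_)
    · simp only [add_re, ofReal_re, mul_re, I_re, mul_zero, ofReal_im, I_im, mul_one, sub_self,
        add_zero, add_im, mul_im, zero_add, smul_eq_mul] at this
      rw [hhor y₀ hy₀.ne' (by rw [abs_of_pos hy₀]) L,
        hhor (-y₀) (by linarith) (by rw [abs_neg, abs_of_pos hy₀]) L, div_neg, Real.arctan_neg] at this
      refine Eq.trans ?_ this
      push_cast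
      ring
    · rintro z ⟨_, hz⟩
      apply hsub
      simp only [Set.mem_preimage, add_im, ofReal_im, mul_im, ofReal_re, I_im, mul_one, I_re,
        mul_zero, add_zero, zero_add] at hz
      rw [Set.uIcc_of_le (by linarith)] at hz
      exact abs_le.2 hz
  have t1 := intervalIntegral_tendsto_integral hint' tendsto_neg_atTop_atBot tendsto_id
  have t2 := intervalIntegral_tendsto_integral hint tendsto_neg_atTop_atBot tendsto_id
  have t3 : Tendsto (fun L : ℝ => ((Real.arctan (L / y₀) : ℝ) : ℂ)) atTop
      (nhds ((Real.pi / 2 : ℝ) : ℂ)) := by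
    refine (Complex.continuous_ofReal.tendsto _).comp ?_
    exact (tendsto_nhds_of_tendsto_nhdsWithin Real.tendsto_arctan_atTop).comp
      (tendsto_id.atTop_div_const hy₀)
  have t4 := (((t1.sub t2).sub (((t3.const_mul (4 * G 0))).mul_const I)).add (hvR.const_mul I)).sub
    (hvL.const_mul I)
  have t5 := tendsto_nhds_unique t4 (tendsto_const_nhds.congr fun L => (hrect L).symm)
  push_cast at t5 ⊢
  linear_combination t5

/-! ### The direction e^{πi/4}; bounds for the denominator and the integrand on tilted lines. -/

lemma siegelDir_eq : siegelDir = ((√2 / 2 : ℝ) : ℂ) * (1 + I) := by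
  rw [siegelDir, show (Real.pi : ℂ) * I / 4 = ((Real.pi / 4 : ℝ) : ℂ) * I by push_cast; ring,
    exp_mul_I, ← ofReal_cos, ← ofReal_sin, Real.cos_pi_div_four, Real.sin_pi_div_four]
  ring

lemma siegelDir_mul_re (z : ℂ) : (siegelDir * z).re = √2 / 2 * (z.re - z.im) := by
  rw [siegelDir_eq]
  simp
  ring

lemma siegelDir_mul_im (z : ℂ) : (siegelDir * z).im = √2 / 2 * (z.re + z.im) := by
  rw [siegelDir_eq]
  simp
  ring

lemma siegelDir_ne_zero : siegelDir ≠ 0 := by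
  rw [siegelDir]
  exact exp_ne_zero _

lemma norm_siegelDir : ‖siegelDir‖ = 1 := by
  rw [siegelDir, show (Real.pi : ℂ) * I / 4 = ((Real.pi / 4 : ℝ) : ℂ) * I by push_cast; ring,
    norm_exp_ofReal_mul_I]

/-- `2 i sin (π x)` in exponential form. -/
noncomputable def siegelDenom (x : ℂ) : ℂ :=
  Complex.exp (Real.pi * I * x) - Complex.exp (-(Real.pi * I * x))

/-- The two exponentials have moduli e^{∓π Im x}, whose difference is 2 sinh(π|Im x|) in absolute
value. This gives the decay on the short sides of the rectangle, where the line need not pass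
through a half-integer. -/
lemma pi_mul_abs_im_le_norm_siegelDenom (x : ℂ) : 2 * Real.pi * |x.im| ≤ ‖siegelDenom x‖ := by
  have h := abs_norm_sub_norm_le (Complex.exp (Real.pi * I * x)) (Complex.exp (-(Real.pi * I * x)))
  refine le_trans ?_ h
  rw [norm_exp, norm_exp]
  have e1 : ((Real.pi : ℂ) * I * x).re = -(Real.pi * x.im) := by simp
  have e2 : (-((Real.pi : ℂ) * I * x)).re = Real.pi * x.im := by simp
  rw [e1, e2]
  have key : ∀ y : ℝ, 0 ≤ y → 2 * y ≤ Real.exp y - Real.exp (-y) := by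
    intro y hy
    have := Real.self_le_sinh_iff.2 hy
    rw [Real.sinh_eq] at this
    linarith
  rcases le_total 0 x.im with h0 | h0
  · rw [abs_sub_comm, abs_of_nonneg h0]
    refine le_trans ?_ (le_abs_self _)
    have := key (Real.pi * x.im) (by positivity)
    linarith
  · rw [abs_of_nonpos h0]
    refine le_trans ?_ (le_abs_self _)
    have := key (-(Real.pi * x.im)) (by have := Real.pi_pos; nlinarith)
    rw [neg_neg] at this
    linarith

/-- The denominator is bounded below on the lines of direction `1 + i` through half-integers. -/
lemma two_le_norm_siegelDenom (k : ℕ) (v : ℝ) :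
    2 ≤ ‖siegelDenom (((k : ℝ) + 1 / 2 + v : ℝ) + v * I)‖ := by
  set x : ℂ := ((k : ℝ) + 1 / 2 + v : ℝ) + v * I with hx
  have h1 : siegelDenom x = 2 * I * Complex.sin (Real.pi * x) := by
    rw [siegelDenom, Complex.sin]
    rw [show -(↑Real.pi * x) * I = -(Real.pi * I * x) by ring,
      show (↑Real.pi * x) * I = (Real.pi * I * x) by ring]
    have := I_mul_I
    linear_combination (Complex.exp (Real.pi * I * x) - Complex.exp (-(Real.pi * I * x))) * this
  have h2 : (Real.pi : ℂ) * x = (Real.pi * v + (Real.pi * v) * I + Real.pi / 2) + k * Real.pi := by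
    rw [hx]; push_cast; ring
  have h3 : ‖Complex.sin (Real.pi * x)‖ = ‖Complex.cos (Real.pi * v + (Real.pi * v) * I)‖ := by
    rw [h2, Complex.sin_antiperiodic.add_nat_mul_eq, norm_mul, norm_pow, norm_neg, norm_one, one_pow, one_mul,
      Complex.sin_add_pi_div_two]
  -- With y = πv, |cos(y + iy)|² = cos² y + sinh² y, which is at least cos² y + sin² y because |sin
  -- y| ≤ |y| ≤ |sinh y|.
  have h4 : 1 ≤ ‖Complex.cos (Real.pi * v + (Real.pi * v) * I)‖ := by
    set y : ℝ := Real.pi * v with hy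
    have e : Complex.cos (Real.pi * v + (Real.pi * v) * I) =
        ((Real.cos y * Real.cosh y : ℝ) : ℂ) + ((-(Real.sin y * Real.sinh y) : ℝ) : ℂ) * I := by
      rw [Complex.cos_add_mul_I, hy]
      push_cast
      ring
    have hn : 1 ≤ ‖Complex.cos (Real.pi * v + (Real.pi * v) * I)‖ ^ 2 := by
      rw [e, ← Complex.normSq_eq_norm_sq, Complex.normSq_add_mul_I]
      have c1 := Real.cosh_sq y
      have c2 := Real.sin_sq_add_cos_sq y
      have c3 : Real.sin y ^ 2 ≤ Real.sinh y ^ 2 := by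
        rw [sq_le_sq]
        refine Real.abs_sin_le_abs.trans ?_
        rcases le_total 0 y with h | h
        · rw [abs_of_nonneg h, abs_of_nonneg (Real.sinh_nonneg_iff.2 h)]
          exact Real.self_le_sinh_iff.2 h
        · rw [abs_of_nonpos h, abs_of_nonpos (Real.sinh_nonpos_iff.2 h)]
          have := Real.sinh_le_self_iff.2 h
          linarith
      have c4 : (Real.cos y * Real.cosh y) ^ 2 + (-(Real.sin y * Real.sinh y)) ^ 2
          = Real.cos y ^ 2 + Real.sinh y ^ 2 := by
        rw [mul_pow, c1, neg_sq, mul_pow]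
        linear_combination Real.sinh y ^ 2 * c2
      rw [c4]
      linarith
    have := norm_nonneg (Complex.cos (Real.pi * v + (Real.pi * v) * I))
    nlinarith
  rw [h1, norm_mul, norm_mul, h3]
  simp only [Complex.norm_ofNat, norm_I]
  linarith

lemma ne_zero_of_line {b v : ℝ} (hb : 0 < b) : ((b + v : ℝ) + v * I : ℂ) ≠ 0 := by
  intro h
  have h1 := congrArg Complex.re h
  have h2 := congrArg Complex.im h
  simp at h1 h2
  rw [h2] at h1
  linarith

lemma norm_siegelIntegrand (s : ℂ) {b v : ℝ} (hb : 0 < b) :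
    ‖siegelIntegrand s ((b + v : ℝ) + v * I)‖ =
      ‖((b + v : ℝ) + v * I : ℂ)‖ ^ (-s.re) *
        Real.exp (s.im * arg ((b + v : ℝ) + v * I) - 2 * Real.pi * (b * v + v ^ 2)) /
        ‖siegelDenom ((b + v : ℝ) + v * I)‖ := by
  have hx := ne_zero_of_line (v := v) hb
  rw [siegelIntegrand, norm_div, norm_mul, norm_cpow_of_ne_zero hx, norm_exp, siegelDenom]
  congr 1
  rw [div_mul_eq_mul_div, mul_div_assoc, ← Real.exp_sub, neg_re, neg_im]
  congr 2
  have : ((Real.pi : ℂ) * I * (((b + v : ℝ) : ℂ) + v * I) ^ 2).re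
      = - 2 * Real.pi * (b * v + v ^ 2) := by
    simp [sq]
    ring
  rw [this]
  ring

/-- The line of direction 1 + i through b stays at distance b/√2 from the origin. -/
lemma norm_line_rpow_le {b v σ : ℝ} (hb : 0 < b) (hσ : 0 ≤ σ) :
    ‖((b + v : ℝ) + v * I : ℂ)‖ ^ (-σ) ≤ (b / 2) ^ (-σ) := by
  refine Real.rpow_le_rpow_of_nonpos (by positivity) ?_ (by linarith)
  refine abs_le_of_sq_le_sq' ?_ (norm_nonneg _) |>.2
  rw [← Complex.normSq_eq_norm_sq, Complex.normSq_add_mul_I]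
  nlinarith [sq_nonneg (b + 2 * v)]

/-- A crude bound, for a fixed `s`, for the integrand on a line of direction `1 + i`. -/
lemma norm_siegelIntegrand_le (s : ℂ) (hs : 0 ≤ s.re) {b v : ℝ} (hb : 0 < b) :
    ‖siegelIntegrand s ((b + v : ℝ) + v * I)‖ ≤
      (b / 2) ^ (-s.re) * Real.exp (Real.pi * |s.im| + Real.pi * b ^ 2) * Real.exp (-(Real.pi * v ^ 2)) /
        ‖siegelDenom ((b + v : ℝ) + v * I)‖ := by
  rw [norm_siegelIntegrand s hb, mul_assoc ((b / 2) ^ (-s.re)), ← Real.exp_add]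
  gcongr ?_ * Real.exp ?_ / _
  · exact norm_line_rpow_le hb hs
  · have h1 : s.im * arg ((b + v : ℝ) + v * I) ≤ Real.pi * |s.im| := by
      refine (le_abs_self _).trans ?_
      rw [abs_mul, mul_comm]
      gcongr
      exact abs_arg_le_pi _
    -- The square (b+v)² ≥ 0 is -2(bv + v²) ≤ b² - v².
    nlinarith [Real.pi_pos, mul_nonneg Real.pi_pos.le (sq_nonneg (b + v))]

/-! ### Shifting the line of integration across the integers. -/

/-- The integral along the line of direction `e^{πi/4}` through `b`. -/
noncomputable def siegelLine (s : ℂ) (b : ℝ) : ℂ :=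
  ∫ u : ℝ, siegelIntegrand s (b + u * siegelDir) * siegelDir

lemma line_eq (b u : ℝ) : (b : ℂ) + u * siegelDir =
    ((b + √2 / 2 * u : ℝ) : ℂ) + ((√2 / 2 * u : ℝ) : ℂ) * I := by
  rw [siegelDir_eq]
  push_cast
  ring

lemma measurable_siegelIntegrand_line (b : ℝ) :
    Measurable fun p : ℂ × ℝ => siegelIntegrand p.1 (b + p.2 * siegelDir) := by
  unfold siegelIntegrand
  fun_prop

lemma sqrt_two_div_two_sq : (√2 / 2) ^ 2 = (1 / 2 : ℝ) := by
  rw [div_pow, Real.sq_sqrt (by norm_num)]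
  norm_num

lemma integrable_siegelIntegrand_line (s : ℂ) (hs : 0 ≤ s.re) (k : ℕ) :
    Integrable fun u : ℝ => siegelIntegrand s (((k : ℝ) + 1 / 2 : ℝ) + u * siegelDir) := by
  have hb : 0 < (k : ℝ) + 1 / 2 := by positivity
  set b : ℝ := (k : ℝ) + 1 / 2 with hbdef
  have hg : Integrable fun u : ℝ => ((b / 2) ^ (-s.re) *
      Real.exp (Real.pi * |s.im| + Real.pi * b ^ 2)) * Real.exp (-(Real.pi / 2) * u ^ 2) :=
    (integrable_exp_neg_mul_sq (by positivity)).const_mul _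
  refine hg.mono' ?_ (ae_of_all _ fun u => ?_)
  · exact ((measurable_siegelIntegrand_line b).comp (measurable_const.prodMk measurable_id)
      (f := fun u : ℝ => (s, u))).aestronglyMeasurable
  · rw [line_eq]
    refine (norm_siegelIntegrand_le s hs hb).trans ?_
    have h2 := two_le_norm_siegelDenom k (√2 / 2 * u)
    rw [← hbdef] at h2
    have e : -(Real.pi * (√2 / 2 * u) ^ 2) = -(Real.pi / 2) * u ^ 2 := by
      rw [mul_pow, sqrt_two_div_two_sq]
      ring
    rw [e]
    exact div_le_self (by positivity) (by linarith)

lemma siegelR_eq_siegelLine (s : ℂ) : siegelR s = -siegelLine s (1 / 2) := by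
  rw [siegelR, siegelLine]
  push_cast
  rfl

lemma siegelDenom_eq_zero {x : ℂ} (hx : siegelDenom x = 0) : ∃ m : ℤ, x = m := by
  rw [siegelDenom, sub_eq_zero, Complex.exp_eq_exp_iff_exists_int] at hx
  obtain ⟨m, hm⟩ := hx
  refine ⟨m, ?_⟩
  have : (Real.pi : ℂ) * I ≠ 0 := by simp [Real.pi_ne_zero]
  apply mul_left_cancel₀ this
  linear_combination hm / 2

/-- Crossing the pole at `n` produces the term `n^{-s}`. -/
lemma siegelLine_succ (s : ℂ) (hs : 0 ≤ s.re) (n : ℕ) :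
    siegelLine s (n + 1 + 1 / 2) - siegelLine s (n + 1 / 2) = ((n + 1 : ℕ) : ℂ) ^ (-s) := by
  set N : ℕ := n + 1 with hN
  set r : ℝ := √2 / 2 with hr
  have hr2 : r ^ 2 = 1 / 2 := sqrt_two_div_two_sq
  have hr0 : 0 < r := by positivity
  have hr1 : r < 1 := by nlinarith
  have hr12 : 1 / 2 < r := by nlinarith
  -- The coordinate z with x = N + e^{πi/4} z makes the lines horizontal: those through N ± 1/2
  -- become Im z = ∓r/2, and the pole at N becomes z = 0.
  set D : ℂ → ℂ := fun z => siegelDenom (N + siegelDir * z) with hD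
  set num : ℂ → ℂ := fun z => (N + siegelDir * z) ^ (-s) *
    Complex.exp (Real.pi * I * (N + siegelDir * z) ^ 2) with hnum
  have hDdiff : Differentiable ℂ D := by
    simp only [hD, siegelDenom]
    fun_prop
  have hexpN : Complex.exp (Real.pi * I * N) = (-1) ^ N := by
    rw [mul_comm, Complex.exp_nat_mul, Complex.exp_pi_mul_I]
  have hexpN' : Complex.exp (-(Real.pi * I * N)) = (-1) ^ N := by
    rw [Complex.exp_neg, hexpN, ← inv_pow]
    norm_num
  have hD0 : D 0 = 0 := by
    simp only [hD, siegelDenom, mul_zero, add_zero]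
    rw [hexpN, hexpN', sub_self]
  have hD' : deriv D 0 = 2 * Real.pi * I * siegelDir * (-1) ^ N := by
    have h1 : HasDerivAt (fun z : ℂ => Real.pi * I * (N + siegelDir * z)) (Real.pi * I * siegelDir) 0 := by
      simpa using (((hasDerivAt_id (0 : ℂ)).const_mul siegelDir).const_add (N : ℂ)).const_mul
        ((Real.pi : ℂ) * I)
    have h2 := h1.cexp.sub h1.neg.cexp
    refine (HasDerivAt.deriv (f := D) (h2.congr_deriv ?_))
    simp only [mul_zero, add_zero, Pi.neg_apply]
    rw [hexpN, hexpN']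
    ring
  -- Dividing D by z removes its simple zero at 0, so G is holomorphic there and G z / z is the
  -- integrand.
  set G : ℂ → ℂ := fun z => num z / dslope D 0 z with hG
  have hGF : ∀ z : ℂ, z ≠ 0 → G z / z = siegelIntegrand s (N + siegelDir * z) := by
    intro z hz
    simp only [hG, hnum, dslope_of_ne _ hz, slope_def_field, hD0]
    rw [siegelIntegrand, ← siegelDenom]
    simp only [hD, sub_zero]
    rw [div_div, div_mul_cancel₀ _ hz]
  set U : Set ℂ := {z | (N + siegelDir * z : ℂ) ∈ slitPlane} ∩ {z | dslope D 0 z ≠ 0} with hU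
  have hdsl : Differentiable ℂ (dslope D 0) := by
    rw [← differentiableOn_univ]
    exact (Complex.differentiableOn_dslope univ_mem).2 hDdiff.differentiableOn
  have hUo : IsOpen U := by
    refine (isOpen_slitPlane.preimage (by fun_prop)).inter ?_
    exact isOpen_compl_singleton.preimage hdsl.continuous
  -- The residue: N² and N have the same parity, so e^{πiN²} cancels the sign (-1)^N in D'(0).
  have hG0 : 2 * Real.pi * I * G 0 * siegelDir = (N : ℂ) ^ (-s) := by
    simp only [hG, dslope_same, hD', hnum, mul_zero, add_zero]
    have : Complex.exp (Real.pi * I * (N : ℂ) ^ 2) = (-1) ^ N := by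
      rw [show (Real.pi : ℂ) * I * (N : ℂ) ^ 2 = ((N * N : ℕ) : ℂ) * (Real.pi * I) by push_cast; ring,
        Complex.exp_nat_mul, Complex.exp_pi_mul_I, pow_mul]
      rcases neg_one_pow_eq_or ℂ N with h | h <;> rw [h]
      · simp
      · exact h
    rw [this]
    have h1 : (Real.pi : ℂ) ≠ 0 := by simp [Real.pi_ne_zero]
    have h2 := siegelDir_ne_zero
    have h3 : ((-1 : ℂ)) ^ N ≠ 0 := pow_ne_zero _ (by norm_num)
    have h4 := I_ne_zero
    field_simp
  have hy₀ : 0 < r / 2 := by positivity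
  have hNr : (1 : ℝ) ≤ N := by
    rw [hN]; push_cast; linarith [(Nat.cast_nonneg n : (0 : ℝ) ≤ n)]
  -- If x is real, then x = N - 2r Im z, so it lies within r² = 1/2 of N: it is positive, off the
  -- cut, and equals no integer other than N.
  have hsub : ∀ z : ℂ, |z.im| ≤ r / 2 → z ∈ U := by
    intro z hz
    have hz' := abs_le.1 hz
    refine ⟨?_, ?_⟩
    · simp only [Set.mem_ofPred_eq, mem_slitPlane_iff, add_re, natCast_re, add_im, natCast_im,
        siegelDir_mul_re, siegelDir_mul_im]
      by_contra! h
      obtain ⟨h1, h2⟩ := h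
      rw [← hr] at h1 h2
      have : z.re + z.im = 0 := by
        rcases mul_eq_zero.1 ((zero_add _).symm.trans h2) with h | h
        · exact absurd h hr0.ne'
        · exact h
      nlinarith
    · simp only [Set.mem_ofPred_eq]
      by_cases h0 : z = 0
      · rw [h0, dslope_same, hD']
        have h2 := siegelDir_ne_zero
        simp [Real.pi_ne_zero, h2]
      · rw [dslope_of_ne _ h0, slope_def_field, hD0]
        simp only [sub_zero]
        refine div_ne_zero ?_ h0
        intro hz0
        obtain ⟨m, hm⟩ := siegelDenom_eq_zero hz0
        have h1 := congrArg Complex.re hm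
        have h2 := congrArg Complex.im hm
        simp only [add_re, natCast_re, intCast_re, add_im, natCast_im, intCast_im,
          siegelDir_mul_re, siegelDir_mul_im] at h1 h2
        rw [← hr] at h1 h2
        have h3 : z.re = -z.im := by
          rcases mul_eq_zero.1 ((zero_add _).symm.trans h2) with h | h
          · exact absurd h hr0.ne'
          · linarith
        have h4 : (m : ℝ) - N = -(2 * r * z.im) := by rw [← h1, h3]; ring
        have h5 : |((m - N : ℤ) : ℝ)| < 1 := by
          push_cast
          rw [h4, abs_neg, abs_mul, abs_of_pos (by positivity : 0 < 2 * r)]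
          nlinarith
        have h6 : m - N = 0 := by
          rw [← Int.cast_abs] at h5
          exact Int.abs_lt_one_iff.1 (by exact_mod_cast h5)
        have h7 : (m : ℝ) - N = 0 := by exact_mod_cast congrArg (Int.cast (R := ℝ)) h6
        have h8 : z.im = 0 := by
          rw [h7] at h4
          nlinarith
        exact h0 (Complex.ext (by simp [h3, h8]) (by simp [h8]))
  have hGd : DifferentiableOn ℂ G U := by
    intro z hz
    have hx : DifferentiableAt ℂ (fun z : ℂ => (N : ℂ) + siegelDir * z) z := by fun_prop
    have h1 : DifferentiableAt ℂ num z :=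
      (hx.cpow (differentiableAt_const _) hz.1).mul
        ((differentiableAt_const _).mul (hx.pow 2)).cexp
    exact (h1.div hdsl.differentiableAt hz.2).differentiableWithinAt
  -- translation of the lines
  have hline : ∀ δ : ℝ, ∀ u : ℝ, (N : ℂ) + siegelDir * ((u + δ * r : ℝ) + (-(δ * r) : ℝ) * I) =
      ((N : ℝ) + δ : ℝ) + u * siegelDir := by
    intro δ u
    have hrc : (r : ℂ) ^ 2 = 1 / 2 := by rw [← ofReal_pow, hr2]; push_cast; rfl
    rw [siegelDir_eq, ← hr]
    push_cast
    linear_combination (2 * δ : ℂ) * hrc - (r : ℂ) ^ 2 * δ * I_sq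
  have hne : ∀ y : ℝ, y ≠ 0 → ∀ x : ℝ, ((x : ℂ) + y * I) ≠ 0 := by
    intro y hy x h
    have := congrArg Complex.im h
    simp at this
    exact hy this
  have htr : ∀ δ : ℝ, δ ≠ 0 → ∀ u : ℝ,
      G ((u + δ * r : ℝ) + (-(δ * r) : ℝ) * I) / ((u + δ * r : ℝ) + (-(δ * r) : ℝ) * I) =
      siegelIntegrand s (((N : ℝ) + δ : ℝ) + u * siegelDir) := by
    intro δ hδ u
    rw [hGF _ (hne _ (neg_ne_zero.2 (mul_ne_zero hδ hr0.ne')) _), hline]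
  have hb1 : ((N : ℝ) + 1 / 2 : ℝ) = (n : ℝ) + 1 + 1 / 2 := by rw [hN]; push_cast; ring
  have hb2 : ((N : ℝ) + (-(1 / 2)) : ℝ) = (n : ℝ) + 1 / 2 := by rw [hN]; push_cast; ring
  have hI1 : Integrable fun u : ℝ => G (u + (r / 2 : ℝ) * I) / (u + (r / 2 : ℝ) * I) := by
    have h := integrable_siegelIntegrand_line s hs n
    rw [← hb2] at h
    have h' := (h.congr (ae_of_all _ fun u => (htr (-(1 / 2)) (by norm_num) u).symm)).comp_add_right
      ((1 / 2) * r)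
    refine h'.congr (ae_of_all _ fun u => ?_)
    simp only
    rw [show u + 1 / 2 * r + -(1 / 2) * r = u by ring, show -(-(1 / 2) * r) = r / 2 by ring]
  have hI2 : Integrable fun u : ℝ => G (u + (-(r / 2) : ℝ) * I) / (u + (-(r / 2) : ℝ) * I) := by
    have h := integrable_siegelIntegrand_line s hs N
    have h' := (h.congr (ae_of_all _ fun u => (htr (1 / 2) (by norm_num) u).symm)).comp_add_right
      (-(1 / 2) * r)
    refine h'.congr (ae_of_all _ fun u => ?_)
    simp only
    rw [show u + -(1 / 2) * r + 1 / 2 * r = u by ring, show -(1 / 2 * r) = -(r / 2) by ring]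
  have hJ1 : ∫ u : ℝ, G (u + (r / 2 : ℝ) * I) / (u + (r / 2 : ℝ) * I) =
      ∫ u : ℝ, siegelIntegrand s (((n : ℝ) + 1 / 2 : ℝ) + u * siegelDir) := by
    rw [← hb2]
    simp_rw [← htr (-(1 / 2)) (by norm_num)]
    rw [integral_add_right_eq_self (fun u : ℝ => G (u + (-(-(1 / 2) * r) : ℝ) * I) /
      (u + (-(-(1 / 2) * r) : ℝ) * I)) (-(1 / 2) * r)]
    rw [show -(-(1 / 2) * r) = r / 2 by ring]
  have hJ2 : ∫ u : ℝ, G (u + (-(r / 2) : ℝ) * I) / (u + (-(r / 2) : ℝ) * I) =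
      ∫ u : ℝ, siegelIntegrand s (((n : ℝ) + 1 + 1 / 2 : ℝ) + u * siegelDir) := by
    rw [← hb1]
    simp_rw [← htr (1 / 2) (by norm_num)]
    rw [integral_add_right_eq_self (fun u : ℝ => G (u + (-((1 / 2) * r) : ℝ) * I) /
      (u + (-((1 / 2) * r) : ℝ) * I)) ((1 / 2) * r)]
    rw [show -((1 / 2) * r) = -(r / 2) by ring]
  -- the vertical sides
  set C : ℝ := (1 / 4 : ℝ) ^ (-s.re) * Real.exp (Real.pi * |s.im| + Real.pi * (N + 1) ^ 2) with hC
  have hside : ∀ x y : ℝ, 1 ≤ |x| → |y| ≤ r / 2 →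
      ‖G (x + y * I) / (x + y * I)‖ ≤ C / |x| := by
    intro x y hx hy
    have hy' := abs_le.1 hy
    have hx0 : x ≠ 0 := by
      rintro rfl
      simp at hx
      linarith
    have hxy : (x : ℂ) + y * I ≠ 0 := by
      intro h
      have := congrArg Complex.re h
      simp at this
      exact hx0 this
    rw [hGF _ hxy]
    set b : ℝ := N - 2 * r * y with hb
    set v : ℝ := r * (x + y) with hv
    have e : (N : ℂ) + siegelDir * (x + y * I) = ((b + v : ℝ) : ℂ) + v * I := by
      rw [siegelDir_eq, ← hr, hb, hv]
      push_cast
      linear_combination (r * y : ℂ) * I_sq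
    have hb1 : 1 / 2 ≤ b := by rw [hb]; nlinarith
    have hb2 : b ≤ N + 1 := by rw [hb]; nlinarith
    have hvx : |x| ≤ 2 * Real.pi * |v| := by
      rw [hv, abs_mul, abs_of_pos hr0]
      have h1 : |x| - |y| ≤ |x + y| := by
        have := abs_sub_abs_le_abs_sub x (-y)
        simpa using this
      have h2 : |x| / 2 ≤ |x + y| := by linarith
      have h3 := Real.pi_gt_three
      have h4 : 2 ≤ 2 * Real.pi * r := by nlinarith
      nlinarith [abs_nonneg (x + y)]
    have hden : |x| ≤ ‖siegelDenom (((b + v : ℝ) : ℂ) + v * I)‖ := by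
      refine hvx.trans ?_
      have := pi_mul_abs_im_le_norm_siegelDenom (((b + v : ℝ) : ℂ) + v * I)
      simpa using this
    rw [e]
    refine (norm_siegelIntegrand_le s hs (by linarith)).trans ?_
    rw [hC]
    have he1 : Real.exp (-(Real.pi * v ^ 2)) ≤ 1 := by
      rw [Real.exp_le_one_iff]
      have := Real.pi_pos
      have : 0 ≤ Real.pi * v ^ 2 := by positivity
      linarith
    have hp1 : (b / 2) ^ (-s.re) ≤ (1 / 4 : ℝ) ^ (-s.re) :=
      Real.rpow_le_rpow_of_nonpos (by norm_num) (by linarith) (by linarith)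
    have hx1 : 0 < |x| := by linarith
    calc (b / 2) ^ (-s.re) * Real.exp (Real.pi * |s.im| + Real.pi * b ^ 2)
          * Real.exp (-(Real.pi * v ^ 2)) / ‖siegelDenom (((b + v : ℝ) : ℂ) + v * I)‖
        ≤ (1 / 4 : ℝ) ^ (-s.re) * Real.exp (Real.pi * |s.im| + Real.pi * (N + 1) ^ 2) * 1 / |x| := by
          have hb0 : 0 ≤ b := by linarith
          gcongr
      _ = _ := by rw [mul_one]
  have hB : Tendsto (fun L : ℝ => C / |L|) atTop (nhds 0) :=
    tendsto_const_nhds.div_atTop tendsto_abs_atTop_atTop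
  have main := integral_strip_sub_eq hy₀ hUo hsub hGd hI1 hI2 hB (fun L hL y hy =>
    ⟨hside L y (hL.trans (le_abs_self _)) hy, by
      have := hside (-L) y (by rw [abs_neg]; exact hL.trans (le_abs_self _)) hy
      rwa [abs_neg] at this⟩)
  rw [hJ1, hJ2] at main
  rw [siegelLine, siegelLine, integral_mul_const, integral_mul_const, ← sub_mul, main, hG0]

/-- Moving the line of integration across the first `k` poles. -/
lemma siegelR_eq_sum_sub (s : ℂ) (hs : 0 ≤ s.re) (k : ℕ) :
    siegelR s = ∑ n ∈ Finset.range k, ((n + 1 : ℕ) : ℂ) ^ (-s) - siegelLine s (k + 1 / 2) := by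
  induction k with
  | zero => simp [siegelR_eq_siegelLine]
  | succ k ih =>
    rw [ih, Finset.sum_range_succ, ← siegelLine_succ s hs k]
    push_cast
    ring

/-! ### The argument along a tilted line, the saddle point, and the main sum. -/

lemma one_add_mem_slitPlane (w : ℝ) : (((1 + w : ℝ) : ℂ) + w * I) ∈ slitPlane := by
  rw [mem_slitPlane_iff]
  by_cases hw : w = 0
  · left; simp [hw]
  · right; simpa using hw

lemma hasDerivAt_arg_line (w : ℝ) :
    HasDerivAt (fun w : ℝ => arg (((1 + w : ℝ) : ℂ) + w * I)) (1 / (1 + 2 * w + 2 * w ^ 2)) w := by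
  have h1 : HasDerivAt (fun w : ℝ => ((1 + w : ℝ) : ℂ) + w * I) (1 + I) w := by
    have h := ((hasDerivAt_id w).const_add 1).ofReal_comp.add ((hasDerivAt_id w).ofReal_comp.mul_const I)
    simp only [id_eq, ofReal_one, one_mul] at h
    exact h
  have h2 := h1.clog_real (one_add_mem_slitPlane w)
  have h3 := Complex.imCLM.hasFDerivAt.comp_hasDerivAt w h2
  simp only [Function.comp_def, Complex.imCLM_apply, Complex.log_im] at h3
  refine h3.congr_deriv ?_
  have hp : 0 < 1 + 2 * w + 2 * w ^ 2 := by nlinarith [sq_nonneg (1 + 2 * w)]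
  have hn : normSq (((1 + w : ℝ) : ℂ) + w * I) = 1 + 2 * w + 2 * w ^ 2 := by
    rw [normSq_add_mul_I]; ring
  rw [div_im, hn]
  simp
  field_simp
  ring

lemma arg_line_zero : arg (((1 + (0 : ℝ) : ℝ) : ℂ) + (0 : ℝ) * I) = 0 := by simp

lemma abs_arg_line_le (w : ℝ) : |arg (((1 + w : ℝ) : ℂ) + w * I)| ≤ 2 * |w| := by
  have h := Convex.norm_image_sub_le_of_norm_hasDerivWithin_le (s := Set.univ) (C := 2)
    (fun x _ => (hasDerivAt_arg_line x).hasDerivWithinAt) (fun x _ => ?_) convex_univ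
    (Set.mem_univ (0 : ℝ)) (Set.mem_univ w)
  · simpa only [arg_line_zero, sub_zero, Real.norm_eq_abs] using h
  · have hp : 0 < 1 + 2 * x + 2 * x ^ 2 := by nlinarith [sq_nonneg (1 + 2 * x)]
    rw [Real.norm_eq_abs, abs_of_pos (by positivity), div_le_iff₀ hp]
    nlinarith [sq_nonneg (1 + 2 * x)]

/-- The derivative of w + w²/2 - arg is w times a nonnegative factor, so the minimum is at 0. The
linear coefficient is exact, so that the linear terms cancel at the saddle point; the quadratic
coefficient 1/2 is below 1, which leaves Gaussian decay against the -v² of e^{πi x²}. -/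
lemma arg_line_le (w : ℝ) : arg (((1 + w : ℝ) : ℂ) + w * I) ≤ w + w ^ 2 / 2 := by
  set f : ℝ → ℝ := fun w => w + w ^ 2 / 2 - arg (((1 + w : ℝ) : ℂ) + w * I) with hf
  have hd : ∀ x, HasDerivAt f (1 + x - 1 / (1 + 2 * x + 2 * x ^ 2)) x := by
    intro x
    refine (((hasDerivAt_id x).add ((hasDerivAt_pow 2 x).div_const 2)).sub
      (hasDerivAt_arg_line x)).congr_deriv ?_
    simp
  have hc : Continuous f := continuous_iff_continuousAt.2 fun x => (hd x).continuousAt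
  have h0 : f 0 = 0 := by simp [hf]
  have key : ∀ x : ℝ, 1 + x - 1 / (1 + 2 * x + 2 * x ^ 2) =
      x * ((3 + 4 * x + 2 * x ^ 2) / (1 + 2 * x + 2 * x ^ 2)) := by
    intro x
    have hp : 0 < 1 + 2 * x + 2 * x ^ 2 := by nlinarith [sq_nonneg (1 + 2 * x)]
    rw [eq_comm, ← mul_div_assoc, div_eq_iff hp.ne', sub_mul, one_div, inv_mul_cancel₀ hp.ne']
    ring
  have hq : ∀ x : ℝ, 0 ≤ (3 + 4 * x + 2 * x ^ 2) / (1 + 2 * x + 2 * x ^ 2) := by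
    intro x
    have hp : 0 < 1 + 2 * x + 2 * x ^ 2 := by nlinarith [sq_nonneg (1 + 2 * x)]
    have : 0 ≤ 3 + 4 * x + 2 * x ^ 2 := by nlinarith [sq_nonneg (1 + x)]
    positivity
  suffices 0 ≤ f w by simp only [hf] at this; linarith
  rcases le_total 0 w with h | h
  · have hm : MonotoneOn f (Set.Ici 0) := by
      refine monotoneOn_of_deriv_nonneg (convex_Ici 0) hc.continuousOn
        (fun x _ => (hd x).differentiableAt.differentiableWithinAt) fun x hx => ?_
      rw [interior_Ici, Set.mem_Ioi] at hx
      rw [(hd x).deriv, key]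
      exact mul_nonneg hx.le (hq x)
    have := hm Set.self_mem_Ici h h
    linarith
  · have hm : AntitoneOn f (Set.Iic 0) := by
      refine antitoneOn_of_deriv_nonpos (convex_Iic 0) hc.continuousOn
        (fun x _ => (hd x).differentiableAt.differentiableWithinAt) fun x hx => ?_
      rw [interior_Iic, Set.mem_Iio] at hx
      rw [(hd x).deriv, key]
      exact mul_nonpos_of_nonpos_of_nonneg hx.le (hq x)
    have := hm h Set.self_mem_Iic h
    linarith

/-- The exponent on the line through the half-integer `b` next to the saddle point `a`. -/
lemma saddle_exponent_le {a b v : ℝ} (ha : 0 < a) (hb : 0 < b) (hab : |a - b| ≤ 1 / 2)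
    (hb2 : 1 / 2 ≤ b) :
    2 * Real.pi * a ^ 2 * arg (((b + v : ℝ) : ℂ) + v * I) - 2 * Real.pi * (b * v + v ^ 2) ≤
      18 * Real.pi - Real.pi / 2 * v ^ 2 := by
  set w : ℝ := v / b with hw
  have hv : v = b * w := by rw [hw]; field_simp
  have harg : arg (((b + v : ℝ) : ℂ) + v * I) = arg (((1 + w : ℝ) : ℂ) + w * I) := by
    rw [← arg_real_mul (((1 + w : ℝ) : ℂ) + w * I) hb, hv]
    congr 1
    push_cast
    ring
  rw [harg]
  set θ := arg (((1 + w : ℝ) : ℂ) + w * I) with hθ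
  have h1 : θ ≤ w + w ^ 2 / 2 := arg_line_le w
  have h2 : |θ| ≤ 2 * |w| := abs_arg_line_le w
  have h3 : b ^ 2 * θ ≤ b * v + v ^ 2 / 2 := by
    rw [hv]; nlinarith [sq_nonneg b]
  -- The price of using the half-integer b instead of the saddle point a: |a - b| ≤ 1/2 and a ≤ 2b
  -- keep it linear in v, uniformly in t.
  have h4 : (a ^ 2 - b ^ 2) * θ ≤ 3 * |v| := by
    have h5 : |a ^ 2 - b ^ 2| ≤ 3 / 2 * b := by
      rw [sq_sub_sq, abs_mul, abs_of_pos (by positivity : 0 < a + b)]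
      have : a ≤ 2 * b := by linarith [(abs_le.1 hab).2]
      nlinarith [abs_nonneg (a - b)]
    calc (a ^ 2 - b ^ 2) * θ ≤ |a ^ 2 - b ^ 2| * |θ| := by
          rw [← abs_mul]; exact le_abs_self _
      _ ≤ (3 / 2 * b) * (2 * |w|) := by gcongr
      _ = 3 * |v| := by rw [hv, abs_mul, abs_of_pos hb]; ring
  -- Half of the quadratic decay absorbs the linear term; 18 is the resulting constant in the
  -- exponent.
  have h6 : 6 * |v| ≤ v ^ 2 / 2 + 18 := by
    rw [← sq_abs v]; nlinarith [sq_nonneg (|v| - 6)]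
  have h7 : 2 * (a ^ 2 * θ - (b * v + v ^ 2)) ≤ 18 - v ^ 2 / 2 := by nlinarith
  nlinarith [Real.pi_pos, mul_le_mul_of_nonneg_left h7 Real.pi_pos.le]

/-- The main sum of Riemann's auxiliary function. -/
noncomputable def siegelSum (σ t : ℝ) : ℂ :=
  ∑ n ∈ Finset.range ⌊√(t / (2 * Real.pi))⌋₊, ((n + 1 : ℕ) : ℂ) ^ (-((σ : ℂ) + t * I))

/-- After ⌊a⌋ poles are crossed, the line passes within 1/2 of the saddle point, where the remaining
integral is dominated by a^{-σ} times a Gaussian that does not depend on t. -/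
theorem exists_norm_siegelR_sub_siegelSum_le (σ : ℝ) (hσ : 0 ≤ σ) :
    ∃ C : ℝ, 0 < C ∧ ∀ t : ℝ, 0 < t →
      ‖siegelR (σ + t * I) - siegelSum σ t‖ ≤ C * √(t / (2 * Real.pi)) ^ (-σ) := by
  set J : ℝ := ∫ u : ℝ, Real.exp (-(Real.pi / 4) * u ^ 2) with hJ
  have hint : Integrable fun u : ℝ => Real.exp (-(Real.pi / 4) * u ^ 2) :=
    integrable_exp_neg_mul_sq (by positivity)
  have hJ0 : 0 ≤ J := integral_nonneg fun u => (Real.exp_pos _).le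
  -- The factor (1/4)^{-σ} comes from b/2 ≥ a/4, and e^{18π} from `saddle_exponent_le`.
  refine ⟨(1 / 4) ^ (-σ) * Real.exp (18 * Real.pi) * (J + 1), by positivity, fun t ht => ?_⟩
  set a : ℝ := √(t / (2 * Real.pi)) with ha
  have ha0 : 0 < a := Real.sqrt_pos.2 (by positivity)
  have hta : t = 2 * Real.pi * a ^ 2 := by
    rw [ha, Real.sq_sqrt (by positivity)]
    field_simp
  set k : ℕ := ⌊a⌋₊ with hk
  have hk1 : (k : ℝ) ≤ a := Nat.floor_le ha0.le
  have hk2 : a < k + 1 := Nat.lt_floor_add_one a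
  set b : ℝ := (k : ℝ) + 1 / 2 with hb
  have hb2 : 1 / 2 ≤ b := by rw [hb]; linarith [(Nat.cast_nonneg k : (0 : ℝ) ≤ k)]
  have hb0 : 0 < b := by linarith
  have hab : |a - b| ≤ 1 / 2 := abs_le.2 ⟨by linarith, by linarith⟩
  have hsre : ((σ : ℂ) + t * I).re = σ := by simp
  have hsim : ((σ : ℂ) + t * I).im = t := by simp
  have e := siegelR_eq_sum_sub ((σ : ℂ) + t * I) (by rw [hsre]; exact hσ) k
  have e2 : siegelR (σ + t * I) - siegelSum σ t = -siegelLine ((σ : ℂ) + t * I) b := by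
    rw [e, siegelSum, hb]
    push_cast
    ring
  rw [e2, norm_neg, siegelLine]
  have hbd : ∀ u : ℝ, ‖siegelIntegrand ((σ : ℂ) + t * I) (b + u * siegelDir) * siegelDir‖ ≤
      ((1 / 4) ^ (-σ) * Real.exp (18 * Real.pi) * a ^ (-σ)) * Real.exp (-(Real.pi / 4) * u ^ 2) := by
    intro u
    rw [norm_mul, norm_siegelDir, mul_one, line_eq, norm_siegelIntegrand _ hb0, hsre, hsim]
    have hd := two_le_norm_siegelDenom k (√2 / 2 * u)
    rw [← hb] at hd
    refine (div_le_self (by positivity) (by linarith)).trans ?_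
    have hp : ‖((b + √2 / 2 * u : ℝ) : ℂ) + (√2 / 2 * u : ℝ) * I‖ ^ (-σ) ≤
        (1 / 4) ^ (-σ) * a ^ (-σ) := by
      refine (norm_line_rpow_le hb0 hσ).trans ?_
      rw [← Real.mul_rpow (by norm_num) ha0.le]
      refine Real.rpow_le_rpow_of_nonpos (by positivity) ?_ (by linarith)
      linarith [(abs_le.1 hab).2]
    have hexp := saddle_exponent_le (v := √2 / 2 * u) ha0 hb0 hab hb2
    rw [← hta, mul_pow _ u, sqrt_two_div_two_sq] at hexp
    calc _ ≤ ((1 / 4) ^ (-σ) * a ^ (-σ)) *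
          Real.exp (18 * Real.pi - Real.pi / 2 * (1 / 2 * u ^ 2)) := by
          rw [mul_pow, sqrt_two_div_two_sq]
          exact mul_le_mul hp (Real.exp_le_exp.2 hexp) (Real.exp_pos _).le (by positivity)
      _ = _ := by
        rw [sub_eq_add_neg, Real.exp_add, show -(Real.pi / 2 * (1 / 2 * u ^ 2))
          = -(Real.pi / 4) * u ^ 2 by ring]
        ring
  refine (norm_integral_le_of_norm_le (hint.const_mul _) (ae_of_all _ hbd)).trans ?_
  rw [integral_const_mul, ← hJ]
  calc _ = (1 / 4) ^ (-σ) * Real.exp (18 * Real.pi) * J * a ^ (-σ) := by ring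
    _ ≤ _ := by gcongr; linarith

lemma measurable_siegelR_line (σ : ℝ) : Measurable fun t : ℝ => siegelR (σ + t * I) := by
  have h : StronglyMeasurable fun p : ℝ × ℝ =>
      siegelIntegrand ((σ : ℂ) + p.1 * I) (((1 / 2 : ℝ) : ℂ) + p.2 * siegelDir) * siegelDir := by
    refine Measurable.stronglyMeasurable (Measurable.mul_const ?_ _)
    exact (measurable_siegelIntegrand_line (1 / 2)).comp
      (f := fun p : ℝ × ℝ => ((σ : ℂ) + p.1 * I, p.2)) (by fun_prop)
  have h2 := (h.integral_prod_right' (ν := volume)).measurable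
  simp_rw [siegelR_eq_siegelLine, siegelLine]
  exact h2.neg

/-! ### Squaring the main sum and exchanging sum and integral. -/

lemma norm_sum_range_sq (z : ℕ → ℂ) (K : ℕ) :
    ‖∑ n ∈ Finset.range K, z n‖ ^ 2 = ∑ n ∈ Finset.range K, ‖z n‖ ^ 2 +
      ∑ n ∈ Finset.range K, 2 * ∑ m ∈ Finset.range n, (z m * (starRingEnd ℂ) (z n)).re := by
  induction K with
  | zero => simp
  | succ K ih =>
    rw [Finset.sum_range_succ, ← Complex.normSq_eq_norm_sq, Complex.normSq_add,
      Complex.normSq_eq_norm_sq, Complex.normSq_eq_norm_sq, ih, Finset.sum_range_succ,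
      Finset.sum_range_succ, Finset.sum_mul, Complex.re_sum]
    ring

/-- The point where the `n`-th term (that of `n + 1`) enters the main sum. -/
lemma lt_floor_sqrt_iff (n : ℕ) (t : ℝ) :
    n < ⌊√(t / (2 * Real.pi))⌋₊ ↔ 2 * Real.pi * ((n : ℝ) + 1) ^ 2 ≤ t := by
  have hp := Real.pi_pos
  rw [← Nat.succ_le_iff, Nat.le_floor_iff (Real.sqrt_nonneg _),
    Real.le_sqrt' (by positivity), le_div_iff₀ (by positivity)]
  push_cast
  rw [mul_comm]

/-- The length of the sum depends on t; indicators move this dependence into the terms, so that a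
fixed finite sum can be integrated termwise. -/
lemma sum_range_floor_eq_indicator {f : ℕ → ℝ → ℝ} {t T : ℝ} (htT : t ≤ T) :
    ∑ n ∈ Finset.range ⌊√(t / (2 * Real.pi))⌋₊, f n t =
      ∑ n ∈ Finset.range ⌊√(T / (2 * Real.pi))⌋₊,
        (Set.Ici (2 * Real.pi * ((n : ℝ) + 1) ^ 2)).indicator (f n) t := by
  have hp := Real.pi_pos
  have hle : ⌊√(t / (2 * Real.pi))⌋₊ ≤ ⌊√(T / (2 * Real.pi))⌋₊ := by
    gcongr
  rw [← Finset.sum_subset (Finset.range_subset_range.2 hle)]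
  · refine Finset.sum_congr rfl fun n hn => ?_
    rw [Finset.mem_range, lt_floor_sqrt_iff n t] at hn
    rw [Set.indicator_of_mem (Set.mem_Ici.2 hn)]
  · intro n _ hn
    rw [Finset.mem_range, lt_floor_sqrt_iff n t] at hn
    rw [Set.indicator_of_notMem (by simpa using hn)]

lemma one_lt_two_pi_mul_sq (n : ℕ) : 1 < 2 * Real.pi * ((n : ℝ) + 1) ^ 2 := by
  have := Real.pi_gt_three
  have h : (1 : ℝ) ≤ ((n : ℝ) + 1) ^ 2 := by
    have : (0 : ℝ) ≤ n := Nat.cast_nonneg n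
    nlinarith
  nlinarith

lemma intervalIntegrable_indicator_Ici {f : ℝ → ℝ} (hf : Continuous f) (c T : ℝ) :
    IntervalIntegrable ((Set.Ici c).indicator f) volume 1 T := by
  rw [intervalIntegrable_iff]
  exact (intervalIntegrable_iff.1 (hf.intervalIntegrable 1 T)).indicator measurableSet_Ici

lemma intervalIntegrable_sum_range_floor {f : ℕ → ℝ → ℝ} (hf : ∀ n, Continuous (f n)) {T : ℝ}
    (hT : 1 ≤ T) :
    IntervalIntegrable (fun t => ∑ n ∈ Finset.range ⌊√(t / (2 * Real.pi))⌋₊, f n t) volume 1 T := by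
  refine IntervalIntegrable.congr (f := fun t => ∑ n ∈ Finset.range ⌊√(T / (2 * Real.pi))⌋₊,
        (Set.Ici (2 * Real.pi * ((n : ℝ) + 1) ^ 2)).indicator (f n) t) ?_ ?_
  · intro t ht
    rw [Set.uIoc_of_le hT] at ht
    exact (sum_range_floor_eq_indicator ht.2).symm
  · have := IntervalIntegrable.sum (Finset.range ⌊√(T / (2 * Real.pi))⌋₊)
      (fun n _ => intervalIntegrable_indicator_Ici (hf n) (2 * Real.pi * ((n : ℝ) + 1) ^ 2) T)
    refine this.congr fun t _ => ?_
    simp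

lemma integral_sum_range_floor {f : ℕ → ℝ → ℝ} (hf : ∀ n, Continuous (f n)) {T : ℝ}
    (hT : 1 ≤ T) :
    ∫ t in (1 : ℝ)..T, ∑ n ∈ Finset.range ⌊√(t / (2 * Real.pi))⌋₊, f n t =
      ∑ n ∈ Finset.range ⌊√(T / (2 * Real.pi))⌋₊,
        ∫ t in (2 * Real.pi * ((n : ℝ) + 1) ^ 2)..T, f n t := by
  have h1 : ∫ t in (1 : ℝ)..T, ∑ n ∈ Finset.range ⌊√(t / (2 * Real.pi))⌋₊, f n t =
      ∫ t in (1 : ℝ)..T, ∑ n ∈ Finset.range ⌊√(T / (2 * Real.pi))⌋₊,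
        (Set.Ici (2 * Real.pi * ((n : ℝ) + 1) ^ 2)).indicator (f n) t := by
    refine intervalIntegral.integral_congr fun t ht => ?_
    rw [Set.uIcc_of_le hT] at ht
    exact sum_range_floor_eq_indicator ht.2
  rw [h1, intervalIntegral.integral_finsetSum fun n _ => intervalIntegrable_indicator_Ici (hf n) _ T]
  refine Finset.sum_congr rfl fun n hn => ?_
  rw [Finset.mem_range, lt_floor_sqrt_iff n T] at hn
  have hc := one_lt_two_pi_mul_sq n
  rw [intervalIntegral.integral_of_le hT, intervalIntegral.integral_of_le hn,
    setIntegral_indicator measurableSet_Ici, ← integral_Icc_eq_integral_Ioc]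
  congr 2
  ext t
  simp only [Set.mem_inter_iff, Set.mem_Ioc, Set.mem_Ici, Set.mem_Icc]
  constructor
  · rintro ⟨⟨_, h2⟩, h3⟩; exact ⟨h3, h2⟩
  · rintro ⟨h1, h2⟩; exact ⟨⟨by linarith, h2⟩, h1⟩

/-! ### Oscillating integrals and the off-diagonal terms. -/

lemma continuous_div_rpow {σ : ℝ} (hσ : 0 ≤ σ) :
    Continuous fun t : ℝ => (t / (2 * Real.pi)) ^ σ :=
  (continuous_id.div_const _).rpow_const fun _ => Or.inr hσ

/-- First derivative test for an oscillating integral with monotone weight. -/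
lemma abs_integral_rpow_mul_cos_le {σ c T l : ℝ} (hσ : 0 ≤ σ) (hc : 0 < c) (hcT : c ≤ T)
    (hl : 0 < l) :
    |∫ t in c..T, (t / (2 * Real.pi)) ^ σ * Real.cos (t * l)| ≤
      2 * (T / (2 * Real.pi)) ^ σ / l := by
  have hp := Real.pi_pos
  set q : ℝ → ℝ := fun t => (t / (2 * Real.pi)) ^ σ with hq
  set q' : ℝ → ℝ := fun t => 1 / (2 * Real.pi) * σ * (t / (2 * Real.pi)) ^ (σ - 1) with hq'
  have hpos : ∀ t ∈ Set.uIcc c T, 0 < t := by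
    intro t ht
    rw [Set.uIcc_of_le hcT] at ht
    linarith [ht.1]
  have hd : ∀ t ∈ Set.uIcc c T, HasDerivAt q (q' t) t := by
    intro t ht
    have := hpos t ht
    exact ((hasDerivAt_id t).div_const (2 * Real.pi)).rpow_const
      (Or.inl (by simp only [id]; positivity))
  have hv : ∀ t ∈ Set.uIcc c T, HasDerivAt (fun t => Real.sin (t * l) / l) (Real.cos (t * l)) t := by
    intro t _
    have := (((hasDerivAt_id t).mul_const l).sin).div_const l
    refine this.congr_deriv ?_
    simp only [id]
    field_simp
  have hq'c : ContinuousOn q' (Set.uIcc c T) := by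
    refine continuousOn_const.mul ((continuousOn_id.div_const _).rpow_const fun t ht => Or.inl ?_)
    have := hpos t ht
    simp only [id]
    positivity
  have hq'i : IntervalIntegrable q' volume c T := hq'c.intervalIntegrable
  have hq'0 : ∀ t ∈ Set.uIcc c T, 0 ≤ q' t := by
    intro t ht
    have := hpos t ht
    simp only [hq']
    positivity
  have hparts := intervalIntegral.integral_mul_deriv_eq_deriv_mul hd hv hq'i
    ((Real.continuous_cos.comp (continuous_id.mul continuous_const)).intervalIntegrable _ _)
  rw [hparts]
  have hint := intervalIntegral.integral_eq_sub_of_hasDerivAt hd hq'i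
  have hrem : |∫ t in c..T, q' t * (Real.sin (t * l) / l)| ≤ (q T - q c) / l := by
    rw [← hint, ← intervalIntegral.integral_div]
    rw [← Real.norm_eq_abs]
    refine intervalIntegral.norm_integral_le_of_norm_le hcT (ae_of_all _ fun t ht => ?_)
      (hq'i.div_const l)
    have h0 := hq'0 t (Set.uIcc_of_le hcT ▸ Set.Ioc_subset_Icc_self ht)
    rw [Real.norm_eq_abs, abs_mul, abs_of_nonneg h0, abs_div, abs_of_pos hl, mul_div_assoc']
    gcongr
    exact mul_le_of_le_one_right h0 (Real.abs_sin_le_one _)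
  have hbdy : ∀ t : ℝ, 0 < t → |q t * (Real.sin (t * l) / l)| ≤ q t / l := by
    intro t ht
    have h0 : 0 ≤ q t := by simp only [hq]; positivity
    rw [abs_mul, abs_of_nonneg h0, abs_div, abs_of_pos hl, mul_div_assoc']
    gcongr
    exact mul_le_of_le_one_right h0 (Real.abs_sin_le_one _)
  have e : 2 * (T / (2 * Real.pi)) ^ σ / l = q T / l + q c / l + (q T - q c) / l := by
    simp only [hq]; ring
  rw [e]
  refine (abs_sub _ _).trans (add_le_add ((abs_sub _ _).trans (add_le_add ?_ ?_)) hrem)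
  · exact hbdy T (by linarith)
  · exact hbdy c hc

/-- By partial fractions the sum is 2H_n/(n+1). The logarithm in H_n is traded for a power 1/4, so
that only powers remain. -/
lemma sum_inv_mul_sub_le (n : ℕ) :
    ∑ m ∈ Finset.range n, 1 / (((m : ℝ) + 1) * ((n : ℝ) - m)) ≤
      10 * ((n : ℝ) + 1) ^ (-(3 / 4) : ℝ) := by
  have hn : (0 : ℝ) ≤ n := Nat.cast_nonneg n
  have h1 : ∀ m ∈ Finset.range n, 1 / (((m : ℝ) + 1) * ((n : ℝ) - m)) =
      ((n : ℝ) + 1)⁻¹ * (((m : ℝ) + 1)⁻¹ + ((n : ℝ) - m)⁻¹) := by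
    intro m hm
    have : (m : ℝ) < n := by exact_mod_cast Finset.mem_range.1 hm
    have h2 : (n : ℝ) - m ≠ 0 := by linarith
    field_simp
    ring
  have h2 : ∑ m ∈ Finset.range n, ((m : ℝ) + 1)⁻¹ = (harmonic n : ℝ) := by
    simp [harmonic]
  have h3 : ∑ m ∈ Finset.range n, ((n : ℝ) - m)⁻¹ = (harmonic n : ℝ) := by
    rw [← h2, ← Finset.sum_range_reflect]
    refine Finset.sum_congr rfl fun m hm => ?_
    have := Finset.mem_range.1 hm
    rw [Nat.cast_sub (by omega), Nat.cast_sub (by omega)]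
    push_cast
    congr 1
    ring
  have h4 : (harmonic n : ℝ) ≤ 5 * ((n : ℝ) + 1) ^ (1 / 4 : ℝ) := by
    have h5 : (harmonic n : ℝ) ≤ 1 + Real.log (n + 1) := by
      rcases Nat.eq_zero_or_pos n with rfl | h
      · simp
      · refine (harmonic_le_one_add_log n).trans ?_
        have : (0 : ℝ) < n := by exact_mod_cast h
        gcongr
        linarith
    have h6 : Real.log (n + 1) ≤ ((n : ℝ) + 1) ^ (1 / 4 : ℝ) / (1 / 4) :=
      Real.log_le_rpow_div (by positivity) (by norm_num)
    have h7 : (1 : ℝ) ≤ ((n : ℝ) + 1) ^ (1 / 4 : ℝ) :=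
      Real.one_le_rpow (by linarith) (by norm_num)
    linarith
  rw [Finset.sum_congr rfl h1, ← Finset.mul_sum, Finset.sum_add_distrib, h2, h3]
  have h8 : ((n : ℝ) + 1) ^ (-(3 / 4) : ℝ) = ((n : ℝ) + 1)⁻¹ * ((n : ℝ) + 1) ^ (1 / 4 : ℝ) := by
    rw [← Real.rpow_neg_one, ← Real.rpow_add (by positivity)]
    norm_num
  rw [h8]
  have h9 : (0 : ℝ) ≤ ((n : ℝ) + 1)⁻¹ := by positivity
  nlinarith [mul_le_mul_of_nonneg_left h4 h9]

/-- After (m+1)(n+1) is extracted, row n is (n+1)^κ times the summable (n+1)^{-5/4}. The two lower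
bounds on κ are what majorizes (m+1)^{1-σ} by a power of n+1, for σ ≥ 1 and σ ≤ 1 respectively. -/
lemma exists_offDiagonal_sum_le {σ κ : ℝ} (hκ : 0 ≤ κ) (h1 : 3 / 2 - σ ≤ κ)
    (h2 : 5 / 2 - 2 * σ ≤ κ) :
    ∃ C : ℝ, 0 ≤ C ∧ ∀ N : ℕ, ∑ n ∈ Finset.range N, ∑ m ∈ Finset.range n,
      (((m : ℝ) + 1) * ((n : ℝ) + 1)) ^ (-σ) * (((n : ℝ) + 1) / ((n : ℝ) - m)) ≤
        C * (N : ℝ) ^ κ := by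
  have hs : Summable fun n : ℕ => ((n : ℝ) + 1) ^ (-(5 / 4) : ℝ) := by
    have := (summable_nat_add_iff 1).2 (Real.summable_nat_rpow.2 (by norm_num : (-(5 / 4) : ℝ) < -1))
    simpa using this
  refine ⟨10 * ∑' n : ℕ, ((n : ℝ) + 1) ^ (-(5 / 4) : ℝ), ?_, fun N => ?_⟩
  · exact mul_nonneg (by norm_num) (tsum_nonneg fun n => by positivity)
  have hrow : ∀ n ∈ Finset.range N, ∑ m ∈ Finset.range n,
      (((m : ℝ) + 1) * ((n : ℝ) + 1)) ^ (-σ) * (((n : ℝ) + 1) / ((n : ℝ) - m)) ≤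
      10 * (N : ℝ) ^ κ * ((n : ℝ) + 1) ^ (-(5 / 4) : ℝ) := by
    intro n hn
    have hnN : (n : ℝ) + 1 ≤ N := by exact_mod_cast Finset.mem_range.1 hn
    have hx : (1 : ℝ) ≤ (n : ℝ) + 1 := by linarith [(Nat.cast_nonneg n : (0 : ℝ) ≤ n)]
    have hx0 : (0 : ℝ) < (n : ℝ) + 1 := by linarith
    have hterm : ∀ m ∈ Finset.range n,
        (((m : ℝ) + 1) * ((n : ℝ) + 1)) ^ (-σ) * (((n : ℝ) + 1) / ((n : ℝ) - m)) ≤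
        ((n : ℝ) + 1) ^ (κ - 1 / 2) * (1 / (((m : ℝ) + 1) * ((n : ℝ) - m))) := by
      intro m hm
      have hmn : (m : ℝ) < n := by exact_mod_cast Finset.mem_range.1 hm
      have hd : 0 < (n : ℝ) - m := by linarith
      have hy : (1 : ℝ) ≤ (m : ℝ) + 1 := by linarith [(Nat.cast_nonneg m : (0 : ℝ) ≤ m)]
      have hy0 : (0 : ℝ) < (m : ℝ) + 1 := by linarith
      have hM : ((m : ℝ) + 1) ^ (1 - σ) ≤ ((n : ℝ) + 1) ^ (κ - 3 / 2 + σ) := by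
        rcases le_total 1 σ with h | h
        · calc ((m : ℝ) + 1) ^ (1 - σ) ≤ 1 := Real.rpow_le_one_of_one_le_of_nonpos hy (by linarith)
            _ ≤ _ := Real.one_le_rpow hx (by linarith)
        · calc ((m : ℝ) + 1) ^ (1 - σ) ≤ ((n : ℝ) + 1) ^ (1 - σ) :=
              Real.rpow_le_rpow hy0.le (by linarith) (by linarith)
            _ ≤ _ := Real.rpow_le_rpow_of_exponent_le hx (by linarith)
      have e1 : (((m : ℝ) + 1) * ((n : ℝ) + 1)) ^ (-σ) * (((n : ℝ) + 1) / ((n : ℝ) - m)) =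
          ((m : ℝ) + 1) ^ (1 - σ) * ((n : ℝ) + 1) ^ (1 - σ) * (1 / (((m : ℝ) + 1) * ((n : ℝ) - m))) := by
        rw [Real.mul_rpow hy0.le hx0.le, show (1 : ℝ) - σ = -σ + 1 by ring,
          Real.rpow_add_one hy0.ne', Real.rpow_add_one hx0.ne']
        field_simp
      have e2 : ((n : ℝ) + 1) ^ (κ - 1 / 2) =
          ((n : ℝ) + 1) ^ (κ - 3 / 2 + σ) * ((n : ℝ) + 1) ^ (1 - σ) := by
        rw [← Real.rpow_add hx0]
        congr 1
        ring
      rw [e1, e2]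
      gcongr
    calc _ ≤ ∑ m ∈ Finset.range n,
          ((n : ℝ) + 1) ^ (κ - 1 / 2) * (1 / (((m : ℝ) + 1) * ((n : ℝ) - m))) := Finset.sum_le_sum hterm
      _ ≤ ((n : ℝ) + 1) ^ (κ - 1 / 2) * (10 * ((n : ℝ) + 1) ^ (-(3 / 4) : ℝ)) := by
          rw [← Finset.mul_sum]
          gcongr
          exact sum_inv_mul_sub_le n
      _ = 10 * ((n : ℝ) + 1) ^ κ * ((n : ℝ) + 1) ^ (-(5 / 4) : ℝ) := by
          rw [mul_left_comm, mul_assoc, ← Real.rpow_add hx0, ← Real.rpow_add hx0]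
          congr 2
          ring
      _ ≤ _ := by gcongr
  calc _ ≤ ∑ n ∈ Finset.range N, 10 * (N : ℝ) ^ κ * ((n : ℝ) + 1) ^ (-(5 / 4) : ℝ) :=
        Finset.sum_le_sum hrow
    _ = 10 * (N : ℝ) ^ κ * ∑ n ∈ Finset.range N, ((n : ℝ) + 1) ^ (-(5 / 4) : ℝ) := by
        rw [Finset.mul_sum]
    _ ≤ 10 * (N : ℝ) ^ κ * ∑' n : ℕ, ((n : ℝ) + 1) ^ (-(5 / 4) : ℝ) := by
        gcongr
        exact hs.sum_le_tsum _ fun n _ => by positivity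
    _ = _ := by ring

/-- The diagonal part of the square of the main sum. -/
noncomputable def diagonalSum (σ t : ℝ) : ℝ :=
  ∑ n ∈ Finset.range ⌊√(t / (2 * Real.pi))⌋₊, ((n : ℝ) + 1) ^ (-(2 * σ))

/-- The off-diagonal part of the square of the main sum. -/
noncomputable def offDiagonalTerm (σ : ℝ) (n : ℕ) (t : ℝ) : ℝ :=
  2 * ∑ m ∈ Finset.range n, (((m : ℝ) + 1) * ((n : ℝ) + 1)) ^ (-σ) *
    Real.cos (t * Real.log (((n : ℝ) + 1) / ((m : ℝ) + 1)))

lemma natCast_cpow_neg_eq (n : ℕ) (σ t : ℝ) : ((n + 1 : ℕ) : ℂ) ^ (-((σ : ℂ) + t * I)) =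
    (((n : ℝ) + 1) ^ (-σ) : ℝ) * Complex.exp ((-(t * Real.log ((n : ℝ) + 1)) : ℝ) * I) := by
  have h0 : (0 : ℝ) < (n : ℝ) + 1 := by positivity
  have e : ((n + 1 : ℕ) : ℂ) = (((n : ℝ) + 1 : ℝ) : ℂ) := by push_cast; ring
  rw [e, cpow_def_of_ne_zero (by exact_mod_cast h0.ne'), Real.rpow_def_of_pos h0, ofReal_exp,
    ← Complex.exp_add, ← ofReal_log h0.le]
  congr 1
  push_cast
  ring

lemma norm_siegelSum_sq (σ t : ℝ) : ‖siegelSum σ t‖ ^ 2 = diagonalSum σ t +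
    ∑ n ∈ Finset.range ⌊√(t / (2 * Real.pi))⌋₊, offDiagonalTerm σ n t := by
  rw [siegelSum, norm_sum_range_sq, diagonalSum]
  congr 1
  · refine Finset.sum_congr rfl fun n _ => ?_
    have h0 : (0 : ℝ) < (n : ℝ) + 1 := by positivity
    rw [natCast_cpow_neg_eq, norm_mul, norm_exp_ofReal_mul_I, mul_one, norm_real, Real.norm_eq_abs,
      sq_abs, ← Real.rpow_natCast, ← Real.rpow_mul h0.le]
    congr 1
    push_cast
    ring
  · refine Finset.sum_congr rfl fun n _ => ?_
    rw [offDiagonalTerm]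
    congr 1
    refine Finset.sum_congr rfl fun m _ => ?_
    have hn : (0 : ℝ) < (n : ℝ) + 1 := by positivity
    have hm : (0 : ℝ) < (m : ℝ) + 1 := by positivity
    rw [natCast_cpow_neg_eq, natCast_cpow_neg_eq, map_mul, conj_ofReal, ← Complex.exp_conj, map_mul,
      conj_ofReal, conj_I, mul_mul_mul_comm, ← Complex.exp_add, ← ofReal_mul, re_ofReal_mul,
      Real.mul_rpow hm.le hn.le, Real.log_div hn.ne' hm.ne']
    congr 1
    rw [show ((-(t * Real.log ((m : ℝ) + 1)) : ℝ) : ℂ) * I + ((-(t * Real.log ((n : ℝ) + 1)) : ℝ) : ℂ) * -I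
      = ((t * (Real.log ((n : ℝ) + 1) - Real.log ((m : ℝ) + 1)) : ℝ) : ℂ) * I by push_cast; ring,
      exp_ofReal_mul_I_re]

lemma continuous_offDiagonalTerm (σ : ℝ) (n : ℕ) : Continuous (offDiagonalTerm σ n) := by
  unfold offDiagonalTerm
  fun_prop

lemma intervalIntegrable_diagonalSum_mul {σ T : ℝ} (hσ : 0 ≤ σ) (hT : 1 ≤ T) :
    IntervalIntegrable (fun t => diagonalSum σ t * (t / (2 * Real.pi)) ^ σ) volume 1 T := by
  simp_rw [diagonalSum, Finset.sum_mul]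
  exact intervalIntegrable_sum_range_floor
    (f := fun n t => ((n : ℝ) + 1) ^ (-(2 * σ)) * (t / (2 * Real.pi)) ^ σ)
    (fun n => continuous_const.mul (continuous_div_rpow hσ)) hT

lemma intervalIntegrable_offDiagonal_mul {σ T : ℝ} (hσ : 0 ≤ σ) (hT : 1 ≤ T) :
    IntervalIntegrable (fun t => (∑ n ∈ Finset.range ⌊√(t / (2 * Real.pi))⌋₊,
      offDiagonalTerm σ n t) * (t / (2 * Real.pi)) ^ σ) volume 1 T := by
  simp_rw [Finset.sum_mul]
  exact intervalIntegrable_sum_range_floor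
    (f := fun n t => offDiagonalTerm σ n t * (t / (2 * Real.pi)) ^ σ)
    (fun n => (continuous_offDiagonalTerm σ n).mul (continuous_div_rpow hσ)) hT

lemma intervalIntegrable_norm_siegelSum_sq_mul {σ T : ℝ} (hσ : 0 ≤ σ) (hT : 1 ≤ T) :
    IntervalIntegrable (fun t => ‖siegelSum σ t‖ ^ 2 * (t / (2 * Real.pi)) ^ σ) volume 1 T := by
  simp_rw [norm_siegelSum_sq, add_mul]
  exact (intervalIntegrable_diagonalSum_mul hσ hT).add (intervalIntegrable_offDiagonal_mul hσ hT)

/-- The first derivative test, with the frequency bounded below by log x ≥ 1 - 1/x at x =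
(n+1)/(m+1). -/
lemma abs_integral_offDiagonalTerm_le {σ T : ℝ} (hσ : 0 ≤ σ) (n : ℕ)
    (hT : 2 * Real.pi * ((n : ℝ) + 1) ^ 2 ≤ T) :
    |∫ t in (2 * Real.pi * ((n : ℝ) + 1) ^ 2)..T, offDiagonalTerm σ n t * (t / (2 * Real.pi)) ^ σ| ≤
      4 * (T / (2 * Real.pi)) ^ σ * ∑ m ∈ Finset.range n,
        (((m : ℝ) + 1) * ((n : ℝ) + 1)) ^ (-σ) * (((n : ℝ) + 1) / ((n : ℝ) - m)) := by
  have hp := Real.pi_pos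
  have hT0 : 0 < T := lt_of_lt_of_le (by positivity) hT
  have e : ∀ t, offDiagonalTerm σ n t * (t / (2 * Real.pi)) ^ σ = ∑ m ∈ Finset.range n,
      2 * (((m : ℝ) + 1) * ((n : ℝ) + 1)) ^ (-σ) * ((t / (2 * Real.pi)) ^ σ *
        Real.cos (t * Real.log (((n : ℝ) + 1) / ((m : ℝ) + 1)))) := by
    intro t
    rw [offDiagonalTerm, Finset.mul_sum, Finset.sum_mul]
    refine Finset.sum_congr rfl fun m _ => ?_
    ring
  have hc : ∀ l : ℝ, Continuous fun t : ℝ => (t / (2 * Real.pi)) ^ σ * Real.cos (t * l) := fun l =>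
    (continuous_div_rpow hσ).mul (by fun_prop)
  simp_rw [e]
  rw [intervalIntegral.integral_finsetSum fun m _ =>
    ((hc _).intervalIntegrable _ _).const_mul _, Finset.mul_sum]
  refine (Finset.abs_sum_le_sum_abs _ _).trans (Finset.sum_le_sum fun m hm => ?_)
  have hmn : (m : ℝ) < n := by exact_mod_cast Finset.mem_range.1 hm
  have hd : 0 < (n : ℝ) - m := by linarith
  have hn0 : (0 : ℝ) < (n : ℝ) + 1 := by positivity
  have hm0 : (0 : ℝ) < (m : ℝ) + 1 := by positivity
  have hlog : ((n : ℝ) - m) / ((n : ℝ) + 1) ≤ Real.log (((n : ℝ) + 1) / ((m : ℝ) + 1)) := by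
    have := Real.one_sub_inv_le_log_of_pos (div_pos hn0 hm0)
    refine le_trans (le_of_eq ?_) this
    field_simp
    ring
  have hl0 : 0 < Real.log (((n : ℝ) + 1) / ((m : ℝ) + 1)) := lt_of_lt_of_le (by positivity) hlog
  rw [intervalIntegral.integral_const_mul, abs_mul, abs_of_nonneg (by positivity)]
  have h1 := abs_integral_rpow_mul_cos_le hσ (by positivity) hT hl0
  have h2 : 1 / Real.log (((n : ℝ) + 1) / ((m : ℝ) + 1)) ≤ ((n : ℝ) + 1) / ((n : ℝ) - m) := by
    rw [one_div, ← inv_div ((n : ℝ) - m)]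
    exact inv_anti₀ (by positivity) hlog
  calc _ ≤ 2 * (((m : ℝ) + 1) * ((n : ℝ) + 1)) ^ (-σ) *
        (2 * (T / (2 * Real.pi)) ^ σ * (1 / Real.log (((n : ℝ) + 1) / ((m : ℝ) + 1)))) := by
        gcongr
        rw [mul_one_div]
        exact h1
    _ ≤ 2 * (((m : ℝ) + 1) * ((n : ℝ) + 1)) ^ (-σ) *
        (2 * (T / (2 * Real.pi)) ^ σ * (((n : ℝ) + 1) / ((n : ℝ) - m))) := by gcongr
    _ = _ := by ring

/-- The mean square of the main sum is that of its diagonal part, up to a small error. -/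
theorem exists_abs_integral_norm_siegelSum_sq_sub_le {σ κ : ℝ} (hσ : 0 ≤ σ) (hκ : 0 ≤ κ)
    (h1 : 3 / 2 - σ ≤ κ) (h2 : 5 / 2 - 2 * σ ≤ κ) :
    ∃ C : ℝ, 0 ≤ C ∧ ∀ T : ℝ, 1 ≤ T →
      |(∫ t in (1 : ℝ)..T, ‖siegelSum σ t‖ ^ 2 * (t / (2 * Real.pi)) ^ σ) -
        ∫ t in (1 : ℝ)..T, diagonalSum σ t * (t / (2 * Real.pi)) ^ σ| ≤ C * T ^ (σ + κ / 2) := by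
  obtain ⟨C, hC0, hC⟩ := exists_offDiagonal_sum_le hκ h1 h2
  refine ⟨4 * C, by positivity, fun T hT => ?_⟩
  have hp := Real.pi_pos
  have hT0 : 0 < T := by linarith
  have e : (∫ t in (1 : ℝ)..T, ‖siegelSum σ t‖ ^ 2 * (t / (2 * Real.pi)) ^ σ) -
        ∫ t in (1 : ℝ)..T, diagonalSum σ t * (t / (2 * Real.pi)) ^ σ =
      ∫ t in (1 : ℝ)..T, ∑ n ∈ Finset.range ⌊√(t / (2 * Real.pi))⌋₊,
        offDiagonalTerm σ n t * (t / (2 * Real.pi)) ^ σ := by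
    rw [← intervalIntegral.integral_sub (intervalIntegrable_norm_siegelSum_sq_mul hσ hT)
      (intervalIntegrable_diagonalSum_mul hσ hT)]
    congr 1
    ext t
    rw [norm_siegelSum_sq, ← Finset.sum_mul]
    ring
  rw [e, integral_sum_range_floor
    (f := fun n t => offDiagonalTerm σ n t * (t / (2 * Real.pi)) ^ σ)
    (fun n => (continuous_offDiagonalTerm σ n).mul (continuous_div_rpow hσ)) hT]
  set N := ⌊√(T / (2 * Real.pi))⌋₊ with hN
  have hN1 : (N : ℝ) ^ κ ≤ T ^ (κ / 2) := by
    have h3 : (N : ℝ) ≤ T ^ (1 / 2 : ℝ) := by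
      rw [← Real.sqrt_eq_rpow]
      refine (Nat.floor_le (Real.sqrt_nonneg _)).trans (Real.sqrt_le_sqrt ?_)
      exact div_le_self hT0.le (by linarith [Real.pi_gt_three])
    calc (N : ℝ) ^ κ ≤ (T ^ (1 / 2 : ℝ)) ^ κ := by gcongr
      _ = T ^ (κ / 2) := by rw [← Real.rpow_mul hT0.le]; congr 1; ring
  have hTσ : (T / (2 * Real.pi)) ^ σ ≤ T ^ σ := by
    gcongr
    exact div_le_self hT0.le (by linarith [Real.pi_gt_three])
  calc _ ≤ ∑ n ∈ Finset.range N, 4 * (T / (2 * Real.pi)) ^ σ * ∑ m ∈ Finset.range n,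
        (((m : ℝ) + 1) * ((n : ℝ) + 1)) ^ (-σ) * (((n : ℝ) + 1) / ((n : ℝ) - m)) := by
        refine (Finset.abs_sum_le_sum_abs _ _).trans (Finset.sum_le_sum fun n hn => ?_)
        rw [Finset.mem_range, hN, lt_floor_sqrt_iff n T] at hn
        exact abs_integral_offDiagonalTerm_le hσ n hn
    _ ≤ 4 * (T / (2 * Real.pi)) ^ σ * (C * (N : ℝ) ^ κ) := by
        rw [← Finset.mul_sum]
        gcongr
        exact hC N
    _ ≤ 4 * T ^ σ * (C * T ^ (κ / 2)) := by gcongr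
    _ = _ := by rw [Real.rpow_add hT0]; ring

/-! ### Partial sums of the zeta and harmonic series. -/

/-- `(s - 1) (x^{-s} - ∫_x^{x+1} y^{-s} dy)` at `x = n + 1`. -/
noncomputable def zetaTerm (n : ℕ) (s : ℂ) : ℂ :=
  (s - 1) * (((n : ℝ) + 1 : ℝ) : ℂ) ^ (-s) - (((n : ℝ) + 1 : ℝ) : ℂ) ^ (1 - s) +
    (((n : ℝ) + 1 + 1 : ℝ) : ℂ) ^ (1 - s)

lemma hasDerivAt_ofReal_add_cpow {x : ℝ} (hx : 0 < x) (c : ℂ) {y : ℝ} (hy : 0 ≤ y) :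
    HasDerivAt (fun y : ℝ => ((x + y : ℝ) : ℂ) ^ c) (c * ((x + y : ℝ) : ℂ) ^ (c - 1)) y := by
  have h1 : HasDerivAt (fun z : ℂ => ((x : ℂ) + z) ^ c) (c * ((x : ℂ) + y) ^ (c - 1) * 1) (y : ℂ) := by
    refine ((hasDerivAt_id (y : ℂ)).const_add (x : ℂ)).cpow_const ?_
    rw [id, ← ofReal_add, ofReal_mem_slitPlane]
    linarith
  have h2 := h1.comp_ofReal
  rw [mul_one] at h2
  push_cast
  exact h2

/-- The mean value inequality is used twice: for y ↦ (x+y)^{-s}, then for φ, whose derivative is a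
difference of such powers. The gained power of x makes the series converge for Re s > 0. -/
lemma norm_zetaTerm_le (n : ℕ) {s : ℂ} (hs : 0 < s.re) :
    ‖zetaTerm n s‖ ≤ ‖s - 1‖ * ‖s‖ * ((n : ℝ) + 1) ^ (-s.re - 1) := by
  set x : ℝ := (n : ℝ) + 1 with hx
  have hx0 : 0 < x := by positivity
  have hψ : ∀ y ∈ Set.Icc (0 : ℝ) 1, ‖((x + y : ℝ) : ℂ) ^ (-s) - (x : ℂ) ^ (-s)‖ ≤
      ‖s‖ * x ^ (-s.re - 1) := by
    intro y hy
    have h := Convex.norm_image_sub_le_of_norm_hasDerivWithin_le (s := Set.Icc (0 : ℝ) 1)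
      (C := ‖s‖ * x ^ (-s.re - 1)) (f := fun y : ℝ => ((x + y : ℝ) : ℂ) ^ (-s))
      (fun y hy => (hasDerivAt_ofReal_add_cpow hx0 (-s) hy.1).hasDerivWithinAt) (fun z hz => ?_)
      (convex_Icc 0 1) (Set.left_mem_Icc.2 zero_le_one) hy
    · rw [add_zero, sub_zero] at h
      refine h.trans (mul_le_of_le_one_right (by positivity) ?_)
      rw [Real.norm_eq_abs, abs_of_nonneg hy.1]
      exact hy.2
    · rw [norm_mul, norm_neg, norm_cpow_eq_rpow_re_of_pos (by linarith [hz.1])]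
      simp only [sub_re, neg_re, one_re]
      gcongr ‖s‖ * ?_
      exact Real.rpow_le_rpow_of_nonpos hx0 (by linarith [hz.1]) (by linarith)
  set φ : ℝ → ℂ := fun y => (s - 1) * (x : ℂ) ^ (-s) * y + ((x + y : ℝ) : ℂ) ^ (1 - s) with hφ
  have hφd : ∀ y ∈ Set.Icc (0 : ℝ) 1, HasDerivAt φ
      (-((s - 1) * (((x + y : ℝ) : ℂ) ^ (-s) - (x : ℂ) ^ (-s)))) y := by
    intro y hy
    have h1 : HasDerivAt (fun y : ℝ => (s - 1) * (x : ℂ) ^ (-s) * (y : ℂ))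
        ((s - 1) * (x : ℂ) ^ (-s) * 1) y :=
      ((hasDerivAt_id (y : ℂ)).const_mul ((s - 1) * (x : ℂ) ^ (-s))).comp_ofReal
    refine (h1.add (hasDerivAt_ofReal_add_cpow hx0 (1 - s) hy.1)).congr_deriv ?_
    rw [show 1 - s - 1 = -s by ring]
    ring
  have h := Convex.norm_image_sub_le_of_norm_hasDerivWithin_le (s := Set.Icc (0 : ℝ) 1)
    (C := ‖s - 1‖ * (‖s‖ * x ^ (-s.re - 1))) (f := φ)
    (fun y hy => (hφd y hy).hasDerivWithinAt) (fun z hz => ?_)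
    (convex_Icc 0 1) (Set.left_mem_Icc.2 zero_le_one) (Set.right_mem_Icc.2 zero_le_one)
  · have e : φ 1 - φ 0 = zetaTerm n s := by
      simp only [hφ, zetaTerm, ← hx]
      push_cast
      simp only [add_zero]
      ring
    rw [e] at h
    simpa [mul_assoc] using h
  · rw [norm_neg, norm_mul]
    gcongr
    exact hψ z hz

lemma sum_zetaTerm (s : ℂ) (N : ℕ) : ∑ n ∈ Finset.range N, zetaTerm n s =
    (s - 1) * ∑ n ∈ Finset.range N, (((n : ℝ) + 1 : ℝ) : ℂ) ^ (-s) - 1 +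
      (((N : ℝ) + 1 : ℝ) : ℂ) ^ (1 - s) := by
  induction N with
  | zero => simp
  | succ N ih =>
    rw [Finset.sum_range_succ, ih, Finset.sum_range_succ, zetaTerm]
    push_cast
    ring

lemma summable_natCast_add_one_rpow {p : ℝ} (hp : p < -1) :
    Summable fun n : ℕ => ((n : ℝ) + 1) ^ p := by
  simpa using (summable_nat_add_iff 1).2 (Real.summable_nat_rpow.2 hp)

lemma summable_zetaTerm {s : ℂ} (hs : 0 < s.re) : Summable fun n => zetaTerm n s :=
  Summable.of_norm_bounded ((summable_natCast_add_one_rpow (by linarith)).mul_left _)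
    fun n => norm_zetaTerm_le n hs

lemma tsum_zetaTerm_of_one_lt {s : ℂ} (hs : 1 < s.re) :
    ∑' n, zetaTerm n s = riemannZeta₁ s - 1 := by
  have hs1 : s ≠ 1 := by
    rintro rfl
    simp at hs
  have h1 := (summable_zetaTerm (s := s) (by linarith)).hasSum.tendsto_sum_nat
  simp_rw [sum_zetaTerm] at h1
  have hsum : Summable fun n : ℕ => (((n : ℝ) + 1 : ℝ) : ℂ) ^ (-s) := by
    refine Summable.of_norm_bounded (summable_natCast_add_one_rpow (p := -s.re) (by linarith))
      fun n => ?_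
    rw [norm_cpow_eq_rpow_re_of_pos (by positivity), neg_re]
  have hz : riemannZeta s = ∑' n : ℕ, (((n : ℝ) + 1 : ℝ) : ℂ) ^ (-s) := by
    rw [zeta_eq_tsum_one_div_nat_add_one_cpow hs]
    refine tsum_congr fun n => ?_
    rw [cpow_neg, one_div]
    push_cast
    rfl
  have h2 : Tendsto (fun N : ℕ => (((N : ℝ) + 1 : ℝ) : ℂ) ^ (1 - s)) atTop (nhds 0) := by
    rw [tendsto_zero_iff_norm_tendsto_zero]
    have h3 : Tendsto (fun N : ℕ => ((N : ℝ) + 1) ^ (-(s.re - 1))) atTop (nhds 0) :=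
      (tendsto_rpow_neg_atTop (by linarith)).comp
        (tendsto_atTop_add_const_right _ _ tendsto_natCast_atTop_atTop)
    refine h3.congr fun N => ?_
    rw [norm_cpow_eq_rpow_re_of_pos (by positivity)]
    simp
  have h4 := ((hsum.hasSum.tendsto_sum_nat.const_mul (s - 1)).sub_const 1).add h2
  rw [tendsto_nhds_unique h1 h4, ← hz, riemannZeta_eq_inv_sub_mul hs1,
    mul_inv_cancel_left₀ (sub_ne_zero.2 hs1), add_zero]

/-- Analytic continuation of the zeta function to `Re s > 0` by the series `zetaTerm`. -/
lemma tsum_zetaTerm {s : ℂ} (hs : 0 < s.re) : ∑' n, zetaTerm n s = riemannZeta₁ s - 1 := by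
  -- The identity theorem is applied on a bounded convex region containing both s and 2. Boundedness
  -- and Re z > δ give one summable majorant.
  set δ : ℝ := min s.re 1 / 2 with hδ
  have hδ0 : 0 < δ := by positivity
  have hδ1 : δ < s.re := by
    have := min_le_left s.re 1
    linarith
  have hδ2 : δ < 2 := by
    have := min_le_right s.re 1
    linarith
  set R : ℝ := ‖s‖ + 3 with hR
  set U : Set ℂ := {z | δ < z.re} ∩ Metric.ball 0 R with hU
  have hUo : IsOpen U := (isOpen_lt continuous_const continuous_re).inter Metric.isOpen_ball
  have hUc : IsPreconnected U :=
    ((convex_halfSpace_re_gt δ).inter (convex_ball 0 R)).isPreconnected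
  have hd1 : DifferentiableOn ℂ (fun s => ∑' n, zetaTerm n s) U := by
    refine differentiableOn_tsum_of_summable_norm
      (u := fun n : ℕ => (R + 1) * R * ((n : ℝ) + 1) ^ (-δ - 1))
      ((summable_natCast_add_one_rpow (by linarith)).mul_left _) (fun n => ?_) hUo ?_
    · have h1 : (((n : ℝ) + 1 : ℝ) : ℂ) ≠ 0 := by
        exact_mod_cast (by positivity : (n : ℝ) + 1 ≠ 0)
      have h2 : (((n : ℝ) + 1 + 1 : ℝ) : ℂ) ≠ 0 := by
        exact_mod_cast (by positivity : (n : ℝ) + 1 + 1 ≠ 0)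
      unfold zetaTerm
      refine Differentiable.differentiableOn (Differentiable.add (Differentiable.sub ?_ ?_) ?_)
      · exact (differentiable_id.sub_const 1).mul (differentiable_id.neg.const_cpow (Or.inl h1))
      · exact (differentiable_id.const_sub 1).const_cpow (Or.inl h1)
      · exact (differentiable_id.const_sub 1).const_cpow (Or.inl h2)
    · rintro n w ⟨hw1, hw2⟩
      have hw1' : δ < w.re := hw1
      have hw3 : ‖w‖ ≤ R := by simpa using (Metric.mem_ball.1 hw2).le
      have hw4 : ‖w - 1‖ ≤ R + 1 := (norm_sub_le _ _).trans (by rw [norm_one]; linarith)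
      refine (norm_zetaTerm_le n (hδ0.trans hw1')).trans ?_
      have hx : (1 : ℝ) ≤ (n : ℝ) + 1 := by linarith [(Nat.cast_nonneg n : (0 : ℝ) ≤ n)]
      gcongr
  have hd2 : DifferentiableOn ℂ (fun s => riemannZeta₁ s - 1) U :=
    (differentiable_riemannZeta₁.sub_const 1).differentiableOn
  have h2U : (2 : ℂ) ∈ U := by
    refine ⟨by simpa using hδ2, ?_⟩
    rw [Metric.mem_ball, dist_zero_right, Complex.norm_ofNat]
    linarith [norm_nonneg s]
  have hsU : s ∈ U := by
    refine ⟨hδ1, ?_⟩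
    rw [Metric.mem_ball, dist_zero_right]
    linarith
  refine (hd1.analyticOnNhd hUo).eqOn_of_preconnected_of_eventuallyEq (hd2.analyticOnNhd hUo) hUc h2U
    ?_ hsU
  have : {z : ℂ | 1 < z.re} ∈ nhds (2 : ℂ) :=
    (isOpen_lt continuous_const continuous_re).mem_nhds (by norm_num)
  filter_upwards [this] with z hz
  exact tsum_zetaTerm_of_one_lt hz

lemma tendsto_sum_rpow_add_zeta {s : ℝ} (hs : 0 < s) (hs1 : s ≠ 1) :
    Tendsto (fun N : ℕ => ∑ n ∈ Finset.range N, ((n : ℝ) + 1) ^ (-s) +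
      ((N : ℝ) + 1) ^ (1 - s) / (s - 1)) atTop (nhds (riemannZeta s).re) := by
  have h1 := (summable_zetaTerm (s := (s : ℂ)) (by simpa using hs)).hasSum.tendsto_sum_nat
  have hs1' : (s : ℂ) ≠ 1 := by exact_mod_cast hs1
  have hs2 : s - 1 ≠ 0 := sub_ne_zero.2 hs1
  rw [tsum_zetaTerm (by simpa using hs)] at h1
  have h2 := ((Complex.continuous_re.tendsto _).comp h1)
  have e : ((riemannZeta₁ s - 1).re + 1) / (s - 1) = (riemannZeta s).re := by
    have : riemannZeta₁ s = ((s - 1 : ℝ) : ℂ) * riemannZeta s := by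
      rw [riemannZeta_eq_inv_sub_mul hs1']
      push_cast
      rw [mul_inv_cancel_left₀ (sub_ne_zero.2 hs1')]
    rw [this, sub_re, re_ofReal_mul, one_re]
    field_simp
    ring
  rw [← e]
  refine ((h2.add_const 1).div_const (s - 1)).congr fun N => ?_
  have e2 : ∑ n ∈ Finset.range N, zetaTerm n (s : ℂ) =
      (((s - 1) * ∑ n ∈ Finset.range N, ((n : ℝ) + 1) ^ (-s) - 1 + ((N : ℝ) + 1) ^ (1 - s) : ℝ) : ℂ) := by
    rw [sum_zetaTerm]
    push_cast
    rw [ofReal_cpow (by positivity)]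
    congr 3
    · refine Finset.sum_congr rfl fun n _ => ?_
      rw [ofReal_cpow (by positivity)]
      push_cast
      rfl
    · push_cast; rfl
    · push_cast; rfl
  simp only [Function.comp_apply]
  rw [e2, ofReal_re]
  field_simp
  ring

/-- The mean value theorem for `x^{1-s} / (1-s)`. -/
lemma rpow_one_sub_div_sub_mem {s x y : ℝ} (hs : 0 ≤ s) (hs1 : s ≠ 1) (hx : 0 < x) (hxy : x < y) :
    x ^ (1 - s) / (s - 1) - y ^ (1 - s) / (s - 1) ∈
      Set.Icc ((y - x) * y ^ (-s)) ((y - x) * x ^ (-s)) := by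
  have hs2 : s - 1 ≠ 0 := sub_ne_zero.2 hs1
  have hd : ∀ z : ℝ, 0 < z → HasDerivAt (fun z : ℝ => -(z ^ (1 - s) / (s - 1))) (z ^ (-s)) z := by
    intro z hz
    refine (((Real.hasDerivAt_rpow_const (p := 1 - s) (Or.inl hz.ne')).div_const (s - 1)).neg).congr_deriv ?_
    rw [show 1 - s - 1 = -s by ring]
    field_simp
    ring
  obtain ⟨c, hc, he⟩ := exists_hasDerivAt_eq_slope (fun z : ℝ => -(z ^ (1 - s) / (s - 1)))
    (fun z => z ^ (-s)) hxy
    (fun z hz => (hd z (by linarith [hz.1])).continuousAt.continuousWithinAt)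
    (fun z hz => hd z (by linarith [hz.1]))
  have h1 : x ^ (1 - s) / (s - 1) - y ^ (1 - s) / (s - 1) = (y - x) * c ^ (-s) := by
    rw [he]
    have : y - x ≠ 0 := by linarith
    field_simp
    ring
  have hc0 : 0 < c := by linarith [hc.1]
  have hyx : 0 ≤ y - x := by linarith
  rw [h1]
  exact ⟨mul_le_mul_of_nonneg_left (Real.rpow_le_rpow_of_nonpos hc0 hc.2.le (by linarith)) hyx,
    mul_le_mul_of_nonneg_left (Real.rpow_le_rpow_of_nonpos hx hc.1.le (by linarith)) hyx⟩

/-- The corrected partial sum E increases to ζ(s), while E(N) + (N+1)^{-s} decreases; both facts are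
the mean value theorem on [k+1, k+2]. So ζ(s) lies between them. -/
lemma abs_sum_rpow_add_sub_zeta_le {s : ℝ} (hs : 0 < s) (hs1 : s ≠ 1) (N : ℕ) :
    |∑ n ∈ Finset.range N, ((n : ℝ) + 1) ^ (-s) + ((N : ℝ) + 1) ^ (1 - s) / (s - 1)
      - (riemannZeta s).re| ≤ ((N : ℝ) + 1) ^ (-s) := by
  set E : ℕ → ℝ := fun N => ∑ n ∈ Finset.range N, ((n : ℝ) + 1) ^ (-s) +
    ((N : ℝ) + 1) ^ (1 - s) / (s - 1) with hE
  have hlim : Tendsto E atTop (nhds (riemannZeta s).re) := tendsto_sum_rpow_add_zeta hs hs1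
  have hstep : ∀ k, E k ≤ E (k + 1) ∧
      E (k + 1) + ((k : ℝ) + 1 + 1) ^ (-s) ≤ E k + ((k : ℝ) + 1) ^ (-s) := by
    intro k
    have h := rpow_one_sub_div_sub_mem hs.le hs1 (x := (k : ℝ) + 1) (y := (k : ℝ) + 1 + 1)
      (by positivity) (by linarith)
    simp only [hE, Finset.sum_range_succ]
    push_cast
    constructor <;> linarith [h.1, h.2]
  have hmono : Monotone E := monotone_nat_of_le_succ fun k => (hstep k).1
  have hanti : Antitone fun k => E k + ((k : ℝ) + 1) ^ (-s) := by
    refine antitone_nat_of_succ_le fun k => ?_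
    push_cast
    exact (hstep k).2
  have h1 : E N ≤ (riemannZeta s).re := hmono.ge_of_tendsto hlim N
  have h2 : (riemannZeta s).re ≤ E N + ((N : ℝ) + 1) ^ (-s) := by
    refine le_of_tendsto hlim ?_
    filter_upwards [eventually_ge_atTop N] with k hk
    have := hanti hk
    simp only at this
    have h0 : 0 ≤ ((k : ℝ) + 1) ^ (-s) := by positivity
    linarith
  rw [abs_sub_comm, abs_of_nonneg (by linarith)]
  linarith

lemma abs_floor_sum_rpow_sub_le {s x : ℝ} (hs : 0 < s) (hs1 : s ≠ 1) (hx : 0 < x) :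
    |∑ n ∈ Finset.range ⌊x⌋₊, ((n : ℝ) + 1) ^ (-s) -
      ((riemannZeta s).re + x ^ (1 - s) / (1 - s))| ≤ 2 * x ^ (-s) := by
  have h1 := abs_le.1 (abs_sum_rpow_add_sub_zeta_le hs hs1 ⌊x⌋₊)
  have hlt : x < (⌊x⌋₊ : ℝ) + 1 := Nat.lt_floor_add_one x
  have hle : (⌊x⌋₊ : ℝ) ≤ x := Nat.floor_le hx.le
  have h2 := rpow_one_sub_div_sub_mem hs.le hs1 hx hlt
  have h3 : ((⌊x⌋₊ : ℝ) + 1) ^ (-s) ≤ x ^ (-s) :=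
    Real.rpow_le_rpow_of_nonpos hx hlt.le (by linarith)
  have h4 : 0 ≤ ((⌊x⌋₊ : ℝ) + 1 - x) * ((⌊x⌋₊ : ℝ) + 1) ^ (-s) :=
    mul_nonneg (by linarith) (by positivity)
  have h5 : ((⌊x⌋₊ : ℝ) + 1 - x) * x ^ (-s) ≤ x ^ (-s) :=
    mul_le_of_le_one_left (by positivity) (by linarith)
  have h6 : x ^ (1 - s) / (1 - s) = -(x ^ (1 - s) / (s - 1)) := by
    rw [← div_neg, neg_sub]
  rw [h6]
  have hp : 0 ≤ x ^ (-s) := by positivity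
  rw [abs_le]
  constructor <;> linarith [h1.1, h1.2, h2.1, h2.2]

/-- With N = ⌊x⌋, γ lies between H_N - log(N+1) and H_{N+1} - log(N+1); replacing log(N+1) by log x
costs at most another 1/x. -/
lemma abs_floor_harmonic_sub_le {x : ℝ} (hx : 0 < x) :
    |(harmonic ⌊x⌋₊ : ℝ) - (Real.log x + Real.eulerMascheroniConstant)| ≤ 2 * x⁻¹ := by
  have hlt : x < (⌊x⌋₊ : ℝ) + 1 := Nat.lt_floor_add_one x
  have hle : (⌊x⌋₊ : ℝ) ≤ x := Nat.floor_le hx.le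
  have h1 := Real.eulerMascheroniSeq_lt_eulerMascheroniConstant ⌊x⌋₊
  have h2 := Real.eulerMascheroniConstant_lt_eulerMascheroniSeq' (⌊x⌋₊ + 1)
  simp only [Real.eulerMascheroniSeq, Real.eulerMascheroniSeq', Nat.add_eq_zero_iff, one_ne_zero,
    and_false, if_false, harmonic_succ] at h1 h2
  push_cast at h2
  have h3 : ((⌊x⌋₊ : ℝ) + 1)⁻¹ ≤ x⁻¹ := inv_anti₀ hx hlt.le
  have h4 : Real.log x ≤ Real.log ((⌊x⌋₊ : ℝ) + 1) := Real.log_le_log hx hlt.le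
  have h5 : Real.log ((⌊x⌋₊ : ℝ) + 1) - Real.log x ≤ x⁻¹ := by
    rw [← Real.log_div (by linarith) hx.ne']
    refine (Real.log_le_sub_one_of_pos (by positivity)).trans ?_
    rw [div_sub_one hx.ne', inv_eq_one_div]
    gcongr
    linarith
  rw [abs_le]
  constructor <;> linarith

/-! ### The weighted diagonal and its mean. -/

lemma integral_div_two_pi_rpow {p T : ℝ} (hp : 0 ≤ p) (hT : 1 ≤ T) :
    ∫ t in (1 : ℝ)..T, (t / (2 * Real.pi)) ^ p =
      T * ((T / (2 * Real.pi)) ^ p / (p + 1)) - (1 / (2 * Real.pi)) ^ p / (p + 1) := by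
  have hpi := Real.pi_pos
  have hd : ∀ t ∈ Set.uIcc 1 T, HasDerivAt (fun t : ℝ => t * ((t / (2 * Real.pi)) ^ p / (p + 1)))
      ((t / (2 * Real.pi)) ^ p) t := by
    intro t ht
    rw [Set.uIcc_of_le hT] at ht
    have ht0 : 0 < t := by linarith [ht.1]
    have h0 : 0 < t / (2 * Real.pi) := by positivity
    have h1 := ((hasDerivAt_id t).div_const (2 * Real.pi)).rpow_const (p := p) (Or.inl h0.ne')
    refine ((hasDerivAt_id t).mul (h1.div_const (p + 1))).congr_deriv ?_
    simp only [id]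
    rw [Real.rpow_sub_one h0.ne']
    field_simp
    ring
  rw [intervalIntegral.integral_eq_sub_of_hasDerivAt hd
    ((continuous_div_rpow hp).intervalIntegrable _ _)]
  ring

lemma integral_sqrt_mul_log {T : ℝ} (hT : 1 ≤ T) :
    ∫ t in (1 : ℝ)..T, (t / (2 * Real.pi)) ^ (1 / 2 : ℝ) * Real.log (t / (2 * Real.pi)) =
      T * ((T / (2 * Real.pi)) ^ (1 / 2 : ℝ) * (2 / 3 * Real.log (T / (2 * Real.pi)) - 4 / 9)) -
        (1 / (2 * Real.pi)) ^ (1 / 2 : ℝ) * (2 / 3 * Real.log (1 / (2 * Real.pi)) - 4 / 9) := by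
  have hpi := Real.pi_pos
  have hpos : ∀ t ∈ Set.uIcc 1 T, 0 < t / (2 * Real.pi) := by
    intro t ht
    rw [Set.uIcc_of_le hT] at ht
    have ht0 : 0 < t := by linarith [ht.1]
    positivity
  have hd : ∀ t ∈ Set.uIcc 1 T, HasDerivAt (fun t : ℝ => t * ((t / (2 * Real.pi)) ^ (1 / 2 : ℝ) *
        (2 / 3 * Real.log (t / (2 * Real.pi)) - 4 / 9)))
      ((t / (2 * Real.pi)) ^ (1 / 2 : ℝ) * Real.log (t / (2 * Real.pi))) t := by
    intro t ht
    have h0 := hpos t ht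
    have ht0 : t ≠ 0 := by
      rintro rfl
      simp at h0
    have hdiv := (hasDerivAt_id t).div_const (2 * Real.pi)
    have h1 := hdiv.rpow_const (p := (1 / 2 : ℝ)) (Or.inl h0.ne')
    have h2 := (((hdiv.log h0.ne').const_mul (2 / 3 : ℝ)).sub_const (4 / 9 : ℝ))
    refine ((hasDerivAt_id t).mul (h1.mul h2)).congr_deriv ?_
    simp only [id, Pi.mul_apply]
    rw [Real.rpow_sub_one h0.ne']
    field_simp
    ring
  rw [intervalIntegral.integral_eq_sub_of_hasDerivAt hd]
  · ring
  · refine ContinuousOn.intervalIntegrable ?_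
    refine (continuous_div_rpow (by norm_num)).continuousOn.mul ?_
    exact (continuousOn_id.div_const _).log fun t ht => (hpos t ht).ne'

/-- The purpose of the weight: an error of order a^{-2σ}, from the diagonal sum or from |R - sum|²,
becomes bounded. -/
lemma sqrt_rpow_neg_mul_self {u σ : ℝ} (hu : 0 < u) : √u ^ (-(2 * σ)) * u ^ σ = 1 := by
  rw [Real.sqrt_eq_rpow, ← Real.rpow_mul hu.le, ← Real.rpow_add hu]
  rw [show 1 / 2 * -(2 * σ) + σ = 0 by ring, Real.rpow_zero]

lemma exists_abs_diagonalSum_mul_sub_le {σ : ℝ} (hσ : 0 ≤ σ) (hσ1 : σ ≠ 1 / 2) :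
    ∃ c : ℝ, (0 < σ → c = (riemannZeta (2 * (σ : ℂ))).re) ∧ ∀ t : ℝ, 0 < t →
      |diagonalSum σ t * (t / (2 * Real.pi)) ^ σ - (c * (t / (2 * Real.pi)) ^ σ +
        1 / (1 - 2 * σ) * (t / (2 * Real.pi)) ^ (1 / 2 : ℝ))| ≤ 2 := by
  have hpi := Real.pi_pos
  have key : ∃ c : ℝ, (0 < σ → c = (riemannZeta (2 * (σ : ℂ))).re) ∧
      ∀ x : ℝ, 0 < x →
      |∑ n ∈ Finset.range ⌊x⌋₊, ((n : ℝ) + 1) ^ (-(2 * σ)) -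
      (c + x ^ (1 - 2 * σ) / (1 - 2 * σ))| ≤ 2 * x ^ (-(2 * σ)) := by
    rcases hσ.eq_or_lt with rfl | h
    -- At σ = 0 the sum is ⌊x⌋ and needs no constant; the zeta value is required only for σ > 0.
    · refine ⟨0, fun h => absurd h (lt_irrefl _), fun x hx => ?_⟩
      simp only [mul_zero, neg_zero, Real.rpow_zero, Finset.sum_const, Finset.card_range, nsmul_eq_mul,
        mul_one, sub_zero, Real.rpow_one, div_one, zero_add]
      have hlt : x < (⌊x⌋₊ : ℝ) + 1 := Nat.lt_floor_add_one x
      have hle : (⌊x⌋₊ : ℝ) ≤ x := Nat.floor_le hx.le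
      rw [abs_le]
      constructor <;> linarith
    · refine ⟨(riemannZeta (2 * (σ : ℂ))).re, fun _ => rfl, fun x hx => ?_⟩
      have := abs_floor_sum_rpow_sub_le (s := 2 * σ) (by linarith)
        (fun h => hσ1 (by linarith)) hx
      push_cast at this
      exact this
  obtain ⟨c, hc1, hc⟩ := key
  refine ⟨c, hc1, fun t ht => ?_⟩
  set u : ℝ := t / (2 * Real.pi) with hu
  have hu0 : 0 < u := by positivity
  have h := hc √u (Real.sqrt_pos.2 hu0)
  have e1 := sqrt_rpow_neg_mul_self (σ := σ) hu0
  have e2 : √u ^ (1 - 2 * σ) * u ^ σ = u ^ (1 / 2 : ℝ) := by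
    rw [Real.sqrt_eq_rpow, ← Real.rpow_mul hu0.le, ← Real.rpow_add hu0]
    congr 1
    ring
  have e3 : diagonalSum σ t * u ^ σ - (c * u ^ σ + 1 / (1 - 2 * σ) * u ^ (1 / 2 : ℝ)) =
      (∑ n ∈ Finset.range ⌊√u⌋₊, ((n : ℝ) + 1) ^ (-(2 * σ)) -
        (c + √u ^ (1 - 2 * σ) / (1 - 2 * σ))) * u ^ σ := by
    rw [diagonalSum, ← hu, ← e2]
    ring
  have hp : 0 < u ^ σ := by positivity
  rw [e3, abs_mul, abs_of_pos hp]
  calc _ ≤ 2 * √u ^ (-(2 * σ)) * u ^ σ := by gcongr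
    _ = 2 := by rw [mul_assoc, e1, mul_one]

lemma abs_diagonalSum_half_mul_sub_le {t : ℝ} (ht : 0 < t) :
    |diagonalSum (1 / 2) t * (t / (2 * Real.pi)) ^ (1 / 2 : ℝ) -
      (1 / 2 * ((t / (2 * Real.pi)) ^ (1 / 2 : ℝ) * Real.log (t / (2 * Real.pi))) +
        Real.eulerMascheroniConstant * (t / (2 * Real.pi)) ^ (1 / 2 : ℝ))| ≤ 2 := by
  have hpi := Real.pi_pos
  set u : ℝ := t / (2 * Real.pi) with hu
  have hu0 : 0 < u := by positivity
  have hs : 0 < √u := Real.sqrt_pos.2 hu0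
  have h := abs_floor_harmonic_sub_le hs
  have e1 : diagonalSum (1 / 2) t = (harmonic ⌊√u⌋₊ : ℝ) := by
    rw [diagonalSum, ← hu]
    simp [harmonic, Real.rpow_neg_one]
  rw [e1, ← Real.sqrt_eq_rpow]
  rw [Real.log_sqrt hu0.le] at h
  have e3 : (harmonic ⌊√u⌋₊ : ℝ) * √u - (1 / 2 * (√u * Real.log u) +
      Real.eulerMascheroniConstant * √u) =
      ((harmonic ⌊√u⌋₊ : ℝ) - (Real.log u / 2 + Real.eulerMascheroniConstant)) * √u := by ring
  rw [e3, abs_mul, abs_of_pos hs]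
  calc _ ≤ 2 * (√u)⁻¹ * √u := by gcongr
    _ = 2 := by field_simp

/-! ### From the main sum to Riemann's auxiliary function. -/

/-- The cross term is split by (|w| - l|d|)² ≥ 0. With l constant in t this integrates to what
Cauchy–Schwarz would give for a well-chosen l. -/
lemma abs_sq_norm_sub_sq_norm_le (z w : ℂ) {l : ℝ} (hl : 0 < l) :
    |‖z‖ ^ 2 - ‖w‖ ^ 2| ≤ ‖w‖ ^ 2 / l + (l + 1) * ‖z - w‖ ^ 2 := by
  have h1 : |‖z‖ - ‖w‖| ≤ ‖z - w‖ := abs_norm_sub_norm_le z w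
  set d := ‖z‖ - ‖w‖ with hd
  have e : ‖z‖ ^ 2 - ‖w‖ ^ 2 = d ^ 2 + 2 * ‖w‖ * d := by rw [hd]; ring
  have h2 : d ^ 2 ≤ ‖z - w‖ ^ 2 := by
    rw [← sq_abs d]
    gcongr
  have h3 : |2 * ‖w‖ * d| ≤ ‖w‖ ^ 2 / l + l * d ^ 2 := by
    have : 0 ≤ (‖w‖ - l * |d|) ^ 2 / l := by positivity
    have e2 : (‖w‖ - l * |d|) ^ 2 / l = ‖w‖ ^ 2 / l + l * d ^ 2 - 2 * ‖w‖ * |d| := by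
      rw [← sq_abs d]
      field_simp
      ring
    rw [abs_mul, abs_of_nonneg (by positivity : 0 ≤ 2 * ‖w‖)]
    linarith
  rw [e]
  calc |d ^ 2 + 2 * ‖w‖ * d| ≤ |d ^ 2| + |2 * ‖w‖ * d| := abs_add_le _ _
    _ ≤ d ^ 2 + (‖w‖ ^ 2 / l + l * d ^ 2) := by rw [abs_of_nonneg (sq_nonneg d)]; gcongr
    _ ≤ ‖w‖ ^ 2 / l + (l + 1) * ‖z - w‖ ^ 2 := by nlinarith

/-- Passage from the mean square of the main sum to that of Riemann's auxiliary function. -/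
lemma exists_abs_weightedMean_sub_le {σ : ℝ} (hσ : 0 ≤ σ) :
    ∃ C : ℝ, 0 ≤ C ∧ ∀ T : ℝ, 1 ≤ T → ∀ l : ℝ, 0 < l →
      |weightedMean σ T - 1 / T * ∫ t in (1 : ℝ)..T, ‖siegelSum σ t‖ ^ 2 * (t / (2 * Real.pi)) ^ σ| ≤
        (1 / T * ∫ t in (1 : ℝ)..T, ‖siegelSum σ t‖ ^ 2 * (t / (2 * Real.pi)) ^ σ) / l +
          (l + 1) * C := by
  obtain ⟨C, hC0, hC⟩ := exists_norm_siegelR_sub_siegelSum_le σ hσ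
  refine ⟨C ^ 2, by positivity, fun T hT l hl => ?_⟩
  have hpi := Real.pi_pos
  have hT0 : 0 < T := by linarith
  set f : ℝ → ℝ := fun t => ‖siegelR (σ + t * I)‖ ^ 2 * (t / (2 * Real.pi)) ^ σ with hf
  set g : ℝ → ℝ := fun t => ‖siegelSum σ t‖ ^ 2 * (t / (2 * Real.pi)) ^ σ with hg
  have hgi : IntervalIntegrable g volume 1 T := intervalIntegrable_norm_siegelSum_sq_mul hσ hT
  have hpt : ∀ t : ℝ, 0 < t → |f t - g t| ≤ g t / l + (l + 1) * C ^ 2 := by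
    intro t ht
    set u : ℝ := t / (2 * Real.pi) with hu
    have hu0 : 0 < u := by positivity
    have hp : 0 < u ^ σ := by positivity
    have h1 := abs_sq_norm_sub_sq_norm_le (siegelR (σ + t * I)) (siegelSum σ t) hl
    have h2 : ‖siegelR (σ + t * I) - siegelSum σ t‖ ^ 2 * u ^ σ ≤ C ^ 2 := by
      have h3 := hC t ht
      rw [← hu] at h3
      calc _ ≤ (C * √u ^ (-σ)) ^ 2 * u ^ σ := by gcongr
        _ = C ^ 2 * (√u ^ (-(2 * σ)) * u ^ σ) := by
            rw [mul_pow, ← Real.rpow_mul_natCast (Real.sqrt_nonneg u)]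
            push_cast
            rw [show -σ * 2 = -(2 * σ) by ring]
            ring
        _ = C ^ 2 := by rw [sqrt_rpow_neg_mul_self hu0, mul_one]
    simp only [hf, hg, ← hu]
    rw [← sub_mul, abs_mul, abs_of_pos hp]
    calc _ ≤ (‖siegelSum σ t‖ ^ 2 / l +
          (l + 1) * ‖siegelR (σ + t * I) - siegelSum σ t‖ ^ 2) * u ^ σ := by gcongr
      _ = ‖siegelSum σ t‖ ^ 2 * u ^ σ / l +
          (l + 1) * (‖siegelR (σ + t * I) - siegelSum σ t‖ ^ 2 * u ^ σ) := by ring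
      _ ≤ _ := by gcongr
  have hdi : IntervalIntegrable (fun t => g t / l + (l + 1) * C ^ 2) volume 1 T :=
    (hgi.div_const l).add intervalIntegrable_const
  have hfm : Measurable f :=
    ((measurable_siegelR_line σ).norm.pow_const 2).mul (continuous_div_rpow hσ).measurable
  -- Integrability of |R|² is not known beforehand; it comes from measurability and the pointwise
  -- bound on f - g.
  have hfgi : IntervalIntegrable (fun t => f t - g t) volume 1 T := by
    refine hdi.mono_fun' ?_ ?_
    · rw [Set.uIoc_of_le hT]
      exact hfm.aestronglyMeasurable.sub hgi.aestronglyMeasurable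
    · rw [Set.uIoc_of_le hT]
      refine (ae_restrict_iff' measurableSet_Ioc).2 (ae_of_all _ fun t ht => ?_)
      exact hpt t (by linarith [ht.1])
  have hfi : IntervalIntegrable f volume 1 T := by
    refine (hfgi.add hgi).congr fun t _ => ?_
    simp
  have h1 : |∫ t in (1 : ℝ)..T, (f t - g t)| ≤ ∫ t in (1 : ℝ)..T, (g t / l + (l + 1) * C ^ 2) := by
    rw [← Real.norm_eq_abs]
    exact intervalIntegral.norm_integral_le_of_norm_le hT
      (ae_of_all _ fun t ht => hpt t (by linarith [ht.1])) hdi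
  have hw : weightedMean σ T = 1 / T * ∫ t in (1 : ℝ)..T, f t := rfl
  rw [hw, ← mul_sub, ← intervalIntegral.integral_sub hfi hgi, abs_mul, abs_of_pos (by positivity)]
  rw [intervalIntegral.integral_add (hgi.div_const l) intervalIntegrable_const,
    intervalIntegral.integral_div, intervalIntegral.integral_const, smul_eq_mul] at h1
  calc _ ≤ 1 / T * ((∫ t in (1 : ℝ)..T, g t) / l + (T - 1) * ((l + 1) * C ^ 2)) := by gcongr
    _ ≤ 1 / T * ((∫ t in (1 : ℝ)..T, g t) / l + T * ((l + 1) * C ^ 2)) := by gcongr; linarith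
    _ = _ := by field_simp

/-- The weighted mean of `|R|²` in terms of the mean of an approximation of the diagonal sum. -/
theorem isBigO_weightedMean_sub {σ κ : ℝ} {main l : ℝ → ℝ} (hσ : 0 ≤ σ) (hκ : 0 ≤ κ)
    (h1 : 3 / 2 - σ ≤ κ) (h2 : 5 / 2 - 2 * σ ≤ κ)
    (hmain : ∀ T, 1 ≤ T → IntervalIntegrable main volume 1 T)
    (hdiag : ∀ t, 0 < t → |diagonalSum σ t * (t / (2 * Real.pi)) ^ σ - main t| ≤ 2)
    (hl : ∀ᶠ T in atTop, 1 ≤ l T)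
    (hmainO : (fun T => 1 / T * ∫ t in (1 : ℝ)..T, main t) =O[atTop] fun T => l T ^ 2)
    (hκl : (fun T : ℝ => T ^ (σ - 1 + κ / 2)) =O[atTop] l) :
    (fun T => weightedMean σ T - 1 / T * ∫ t in (1 : ℝ)..T, main t) =O[atTop] l := by
  obtain ⟨C₁, hC₁, hR⟩ := exists_abs_weightedMean_sub_le hσ
  obtain ⟨C₂, hC₂, hS⟩ := exists_abs_integral_norm_siegelSum_sq_sub_le hσ hκ h1 h2
  obtain ⟨A, hA, hAb⟩ := hmainO.exists_pos
  obtain ⟨B, hB, hBb⟩ := hκl.exists_pos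
  refine IsBigO.of_bound ((A + 2 + C₂ * B) + 2 * C₁ + (2 + C₂ * B)) ?_
  filter_upwards [hAb.bound, hBb.bound, hl, eventually_ge_atTop 1] with T hA1 hB1 hl1 hT
  have hT0 : 0 < T := by linarith
  have hl0 : 0 < l T := by linarith
  set P : ℝ := 1 / T * ∫ t in (1 : ℝ)..T, ‖siegelSum σ t‖ ^ 2 * (t / (2 * Real.pi)) ^ σ with hP
  set D : ℝ := 1 / T * ∫ t in (1 : ℝ)..T, diagonalSum σ t * (t / (2 * Real.pi)) ^ σ with hD
  set M : ℝ := 1 / T * ∫ t in (1 : ℝ)..T, main t with hM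
  rw [Real.norm_eq_abs, Real.norm_eq_abs, abs_of_nonneg (sq_nonneg (l T))] at hA1
  rw [Real.norm_eq_abs, Real.norm_eq_abs, abs_of_pos hl0, abs_of_nonneg (by positivity)] at hB1
  rw [Real.norm_eq_abs, Real.norm_eq_abs, abs_of_pos hl0]
  have hPD : |P - D| ≤ C₂ * B * l T := by
    rw [hP, hD, ← mul_sub, abs_mul, abs_of_pos (by positivity)]
    calc _ ≤ 1 / T * (C₂ * T ^ (σ + κ / 2)) := by gcongr; exact hS T hT
      _ = C₂ * T ^ (σ - 1 + κ / 2) := by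
          rw [show σ - 1 + κ / 2 = σ + κ / 2 - 1 by ring, Real.rpow_sub_one hT0.ne']
          ring
      _ ≤ C₂ * (B * l T) := by gcongr
      _ = _ := by ring
  have hDM : |D - M| ≤ 2 := by
    rw [hD, hM, ← mul_sub, abs_mul, abs_of_pos (by positivity),
      ← intervalIntegral.integral_sub (intervalIntegrable_diagonalSum_mul hσ hT) (hmain T hT)]
    have h3 := intervalIntegral.norm_integral_le_of_norm_le_const (a := 1) (b := T) (C := 2)
      (f := fun t => diagonalSum σ t * (t / (2 * Real.pi)) ^ σ - main t) (fun t ht => by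
        rw [Set.uIoc_of_le hT] at ht
        exact hdiag t (by linarith [ht.1]))
    rw [Real.norm_eq_abs, abs_of_nonneg (by linarith : 0 ≤ T - 1)] at h3
    calc _ ≤ 1 / T * (2 * (T - 1)) := by gcongr
      _ ≤ 1 / T * (2 * T) := by gcongr; linarith
      _ = 2 := by field_simp
  have hPM : |P - M| ≤ (2 + C₂ * B) * l T := by
    calc |P - M| ≤ |P - D| + |D - M| := abs_sub_le _ _ _
      _ ≤ C₂ * B * l T + 2 * l T := by gcongr; linarith
      _ = _ := by ring
  -- The choice of l balances the cross terms: P = O(l²) makes both P/l and (l+1)C₁ of order l.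
  have hPle : P ≤ (A + 2 + C₂ * B) * l T ^ 2 := by
    have h4 : P ≤ |M| + |P - M| := by
      have := le_abs_self (P - M)
      have := le_abs_self M
      linarith
    have h5 : (2 + C₂ * B) * l T ≤ (2 + C₂ * B) * l T ^ 2 := by
      gcongr
      nlinarith
    linarith
  have hRP := hR T hT (l T) hl0
  rw [← hP] at hRP
  have h6 : P / l T ≤ (A + 2 + C₂ * B) * l T := by
    rw [div_le_iff₀ hl0]
    linarith
  have h7 : (l T + 1) * C₁ ≤ 2 * C₁ * l T := by nlinarith
  calc |weightedMean σ T - M| ≤ |weightedMean σ T - P| + |P - M| := abs_sub_le _ _ _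
    _ ≤ _ := by linarith

/-! ### Assembling the asymptotic formulas. -/

lemma isBigO_div_two_pi_rpow {p q : ℝ} (hp : 0 ≤ p) (hpq : p ≤ q) :
    (fun T : ℝ => (T / (2 * Real.pi)) ^ p) =O[atTop] fun T : ℝ => T ^ q := by
  have hpi := Real.pi_gt_three
  refine IsBigO.of_bound 1 ?_
  filter_upwards [eventually_ge_atTop 1] with T hT
  have hT0 : 0 < T := by linarith
  rw [Real.norm_eq_abs, Real.norm_eq_abs, abs_of_nonneg (by positivity), abs_of_nonneg (by positivity),
    one_mul]
  calc (T / (2 * Real.pi)) ^ p ≤ T ^ p := by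
        gcongr
        exact div_le_self hT0.le (by linarith)
    _ ≤ T ^ q := Real.rpow_le_rpow_of_exponent_le hT hpq

lemma isBigO_rpow_rpow {p q : ℝ} (hpq : p ≤ q) :
    (fun T : ℝ => T ^ p) =O[atTop] fun T : ℝ => T ^ q := by
  refine IsBigO.of_bound 1 ?_
  filter_upwards [eventually_ge_atTop 1] with T hT
  have hT0 : 0 < T := by linarith
  rw [Real.norm_eq_abs, Real.norm_eq_abs, abs_of_nonneg (by positivity), abs_of_nonneg (by positivity),
    one_mul]
  exact Real.rpow_le_rpow_of_exponent_le hT hpq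

lemma isBigO_one_div_mul {l : ℝ → ℝ} (hl : ∀ᶠ T in atTop, 1 ≤ l T) (k : ℝ) :
    (fun T : ℝ => 1 / T * k) =O[atTop] l := by
  refine IsBigO.of_bound |k| ?_
  filter_upwards [hl, eventually_ge_atTop 1] with T hlT hT
  have hT0 : 0 < T := by linarith
  rw [Real.norm_eq_abs, Real.norm_eq_abs, abs_mul,
    abs_of_pos (by positivity : 0 < 1 / T), abs_of_pos (by linarith : 0 < l T)]
  have h1 : 1 / T ≤ l T := ((div_le_one hT0).2 hT).trans hlT
  rw [mul_comm |k|]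
  gcongr

lemma eventually_one_le_rpow {q : ℝ} (hq : 0 ≤ q) : ∀ᶠ T : ℝ in atTop, 1 ≤ T ^ q := by
  filter_upwards [eventually_ge_atTop 1] with T hT
  exact Real.one_le_rpow hT hq

/-- The asymptotic formula for `σ ≠ 1/2`, with both main terms. -/
theorem exists_isBigO_weightedMean_sub_rpow {σ κ q : ℝ} (hσ : 0 ≤ σ) (hσ1 : σ ≠ 1 / 2) (hκ : 0 ≤ κ)
    (h1 : 3 / 2 - σ ≤ κ) (h2 : 5 / 2 - 2 * σ ≤ κ) (hq : 1 / 4 ≤ q) (hσq : σ ≤ 2 * q)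
    (hκq : σ - 1 + κ / 2 ≤ q) :
    ∃ c : ℝ, (0 < σ → c = (riemannZeta (2 * (σ : ℂ))).re) ∧
      (fun T : ℝ => weightedMean σ T - (c / (σ + 1) * (T / (2 * Real.pi)) ^ σ +
        2 / (3 * (1 - 2 * σ)) * (T / (2 * Real.pi)) ^ (1 / 2 : ℝ))) =O[atTop]
          fun T : ℝ => T ^ q := by
  obtain ⟨c, hc, hdiag⟩ := exists_abs_diagonalSum_mul_sub_le hσ hσ1
  refine ⟨c, hc, ?_⟩
  set main : ℝ → ℝ := fun t => c * (t / (2 * Real.pi)) ^ σ +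
        1 / (1 - 2 * σ) * (t / (2 * Real.pi)) ^ (1 / 2 : ℝ) with hmain
  have hσ2 : 1 - 2 * σ ≠ 0 := fun h => hσ1 (by linarith)
  have hi1 : ∀ T, IntervalIntegrable (fun t : ℝ => c * (t / (2 * Real.pi)) ^ σ) volume 1 T :=
    fun T => ((continuous_div_rpow hσ).intervalIntegrable _ _).const_mul c
  have hi2 : ∀ T, IntervalIntegrable
      (fun t : ℝ => 1 / (1 - 2 * σ) * (t / (2 * Real.pi)) ^ (1 / 2 : ℝ)) volume 1 T :=
    fun T => ((continuous_div_rpow (by norm_num)).intervalIntegrable _ _).const_mul _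
  -- The contribution of the lower endpoint t = 1, which is O(1/T) in the mean.
  set k : ℝ := c * ((1 / (2 * Real.pi)) ^ σ / (σ + 1)) +
    1 / (1 - 2 * σ) * ((1 / (2 * Real.pi)) ^ (1 / 2 : ℝ) / (1 / 2 + 1)) with hk
  have hmean : ∀ T : ℝ, 1 ≤ T → 1 / T * ∫ t in (1 : ℝ)..T, main t =
      (c / (σ + 1) * (T / (2 * Real.pi)) ^ σ +
        2 / (3 * (1 - 2 * σ)) * (T / (2 * Real.pi)) ^ (1 / 2 : ℝ)) - 1 / T * k := by
    intro T hT
    have hT0 : T ≠ 0 := by linarith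
    simp only [hmain]
    rw [intervalIntegral.integral_add (hi1 T) (hi2 T), intervalIntegral.integral_const_mul,
      intervalIntegral.integral_const_mul, integral_div_two_pi_rpow hσ hT,
      integral_div_two_pi_rpow (by norm_num) hT, hk]
    have : σ + 1 ≠ 0 := by linarith
    field_simp
    ring
  have hlq := eventually_one_le_rpow (by linarith : 0 ≤ q)
  have hl2q := eventually_one_le_rpow (by linarith : 0 ≤ 2 * q)
  have hsq : (fun T : ℝ => (T ^ q) ^ 2) =ᶠ[atTop] fun T => T ^ (2 * q) := by
    filter_upwards [eventually_ge_atTop 0] with T hT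
    rw [← Real.rpow_mul_natCast hT, mul_comm]
    push_cast
    rfl
  have hbig : (fun T : ℝ => 1 / T * ∫ t in (1 : ℝ)..T, main t) =O[atTop] fun T => (T ^ q) ^ 2 := by
    refine IsBigO.trans_eventuallyEq ?_ hsq.symm
    refine (((((isBigO_div_two_pi_rpow hσ hσq).const_mul_left (c / (σ + 1))).add
      ((isBigO_div_two_pi_rpow (p := 1 / 2) (q := 2 * q) (by norm_num) (by linarith)).const_mul_left
      (2 / (3 * (1 - 2 * σ))))).sub (isBigO_one_div_mul hl2q k))).congr' ?_ EventuallyEq.rfl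
    filter_upwards [eventually_ge_atTop 1] with T hT
    exact (hmean T hT).symm
  have hfin := isBigO_weightedMean_sub hσ hκ h1 h2 (main := main)
    (fun T _ => (hi1 T).add (hi2 T)) hdiag hlq hbig (isBigO_rpow_rpow hκq)
  refine (hfin.sub (isBigO_one_div_mul hlq k)).congr' ?_ EventuallyEq.rfl
  filter_upwards [eventually_ge_atTop 1] with T hT
  rw [hmean T hT]
  ring

/-- The asymptotic formula on the critical line. -/
theorem isBigO_weightedMean_half_sub :
    (fun T : ℝ => weightedMean (1 / 2) T
      - (1 / 3 * (T / (2 * Real.pi)) ^ (1 / 2 : ℝ) * Real.log (T / (2 * Real.pi))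
        + 2 * ((3 * Real.eulerMascheroniConstant - 1) / 9) * (T / (2 * Real.pi)) ^ (1 / 2 : ℝ)))
      =O[atTop] fun T : ℝ => T ^ (1 / 4 : ℝ) * Real.sqrt (Real.log T) := by
  have hpi := Real.pi_gt_three
  set γ := Real.eulerMascheroniConstant with hγ
  set main : ℝ → ℝ := fun t => 1 / 2 * ((t / (2 * Real.pi)) ^ (1 / 2 : ℝ) *
    Real.log (t / (2 * Real.pi))) + γ * (t / (2 * Real.pi)) ^ (1 / 2 : ℝ) with hmain
  set l : ℝ → ℝ := fun T => T ^ (1 / 4 : ℝ) * Real.sqrt (Real.log T) with hl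
  have hi1 : ∀ T, 1 ≤ T → IntervalIntegrable (fun t : ℝ => 1 / 2 * ((t / (2 * Real.pi)) ^ (1 / 2 : ℝ) *
      Real.log (t / (2 * Real.pi)))) volume 1 T := by
    intro T hT
    refine (ContinuousOn.intervalIntegrable ?_).const_mul _
    refine (continuous_div_rpow (by norm_num)).continuousOn.mul
      ((continuousOn_id.div_const _).log fun t ht => ?_)
    rw [Set.uIcc_of_le hT] at ht
    have : 0 < t := by linarith [ht.1]
    simp only [id]
    positivity
  have hi2 : ∀ T, IntervalIntegrable (fun t : ℝ => γ * (t / (2 * Real.pi)) ^ (1 / 2 : ℝ)) volume 1 T :=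
    fun T => ((continuous_div_rpow (by norm_num)).intervalIntegrable _ _).const_mul _
  set k : ℝ := 1 / 2 * ((1 / (2 * Real.pi)) ^ (1 / 2 : ℝ) *
    (2 / 3 * Real.log (1 / (2 * Real.pi)) - 4 / 9)) +
    γ * ((1 / (2 * Real.pi)) ^ (1 / 2 : ℝ) / (1 / 2 + 1)) with hk
  have hmean : ∀ T : ℝ, 1 ≤ T → 1 / T * ∫ t in (1 : ℝ)..T, main t =
      (1 / 3 * (T / (2 * Real.pi)) ^ (1 / 2 : ℝ) * Real.log (T / (2 * Real.pi))
        + 2 * ((3 * γ - 1) / 9) * (T / (2 * Real.pi)) ^ (1 / 2 : ℝ)) - 1 / T * k := by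
    intro T hT
    have hT0 : T ≠ 0 := by linarith
    simp only [hmain]
    rw [intervalIntegral.integral_add (hi1 T hT) (hi2 T), intervalIntegral.integral_const_mul,
      intervalIntegral.integral_const_mul, integral_sqrt_mul_log hT,
      integral_div_two_pi_rpow (by norm_num) hT, hk]
    field_simp
    ring
  have hlog : ∀ᶠ T : ℝ in atTop, 1 ≤ Real.log T := Real.tendsto_log_atTop.eventually_ge_atTop 1
  have hl1 : ∀ᶠ T : ℝ in atTop, 1 ≤ l T := by
    filter_upwards [hlog, eventually_ge_atTop 1] with T h1 h2
    exact one_le_mul_of_one_le_of_one_le (Real.one_le_rpow h2 (by norm_num)) (Real.one_le_sqrt.2 h1)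
  have hquarter : (fun T : ℝ => T ^ (1 / 4 : ℝ)) =O[atTop] l := by
    refine IsBigO.of_bound 1 ?_
    filter_upwards [hlog, eventually_ge_atTop 1] with T h1 h2
    rw [one_mul, hl, norm_mul]
    refine le_mul_of_one_le_right (norm_nonneg _) ?_
    rw [Real.norm_eq_abs, abs_of_nonneg (Real.sqrt_nonneg _)]
    exact Real.one_le_sqrt.2 h1
  have hsq : (fun T : ℝ => l T ^ 2) =ᶠ[atTop] fun T => T ^ (1 / 2 : ℝ) * Real.log T := by
    filter_upwards [hlog, eventually_ge_atTop 0] with T h1 hT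
    rw [hl, mul_pow, Real.sq_sqrt (by linarith), ← Real.rpow_mul_natCast hT]
    norm_num
  have hbig1 : (fun T : ℝ => (T / (2 * Real.pi)) ^ (1 / 2 : ℝ) * Real.log (T / (2 * Real.pi))) =O[atTop]
      fun T => T ^ (1 / 2 : ℝ) * Real.log T := by
    refine (isBigO_div_two_pi_rpow (by norm_num) le_rfl).mul (IsBigO.of_bound 1 ?_)
    filter_upwards [eventually_ge_atTop (2 * Real.pi)] with T hT
    have h1 : 1 ≤ T / (2 * Real.pi) := (one_le_div (by positivity)).2 hT
    have hT0 : 0 < T := by linarith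
    rw [one_mul, Real.norm_eq_abs, Real.norm_eq_abs, abs_of_nonneg (Real.log_nonneg h1),
      abs_of_nonneg (Real.log_nonneg (by linarith))]
    exact Real.log_le_log (by linarith) (div_le_self hT0.le (by linarith))
  have hbig2 : (fun T : ℝ => (T / (2 * Real.pi)) ^ (1 / 2 : ℝ)) =O[atTop]
      fun T => T ^ (1 / 2 : ℝ) * Real.log T := by
    refine (isBigO_div_two_pi_rpow (by norm_num) le_rfl).trans (IsBigO.of_bound 1 ?_)
    filter_upwards [hlog] with T h1
    rw [one_mul, norm_mul]
    refine le_mul_of_one_le_right (norm_nonneg _) ?_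
    rw [Real.norm_eq_abs]
    exact h1.trans (le_abs_self _)
  have hl2 : ∀ᶠ T : ℝ in atTop, 1 ≤ T ^ (1 / 2 : ℝ) * Real.log T := by
    filter_upwards [hlog, eventually_ge_atTop 1] with T h1 h2
    exact one_le_mul_of_one_le_of_one_le (Real.one_le_rpow h2 (by norm_num)) h1
  have hbig : (fun T : ℝ => 1 / T * ∫ t in (1 : ℝ)..T, main t) =O[atTop] fun T => l T ^ 2 := by
    refine IsBigO.trans_eventuallyEq ?_ hsq.symm
    refine (((hbig1.const_mul_left (1 / 3)).add
      (hbig2.const_mul_left (2 * ((3 * γ - 1) / 9)))).sub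
      (isBigO_one_div_mul hl2 k)).congr' ?_ EventuallyEq.rfl
    filter_upwards [eventually_ge_atTop 1] with T hT
    rw [hmean T hT]
    ring
  -- κ = 3/2 is the least value allowed at σ = 1/2; the off-diagonal part is then O(T^{1/4}).
  have hfin := isBigO_weightedMean_sub (σ := 1 / 2) (κ := 3 / 2) (by norm_num) (by norm_num)
    (by norm_num) (by norm_num) (main := main)
    (fun T hT => (hi1 T hT).add (hi2 T)) (fun t ht => abs_diagonalSum_half_mul_sub_le ht) hl1 hbig
    (by norm_num; norm_num at hquarter; exact hquarter)
  refine (hfin.sub (isBigO_one_div_mul hl1 k)).congr' ?_ EventuallyEq.rfl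
  filter_upwards [eventually_ge_atTop 1] with T hT
  rw [hmean T hT]
  ring

theorem theorem1 (σ : ℝ) (hσ : 0 ≤ σ) :
    (σ ≤ 1 / 4 →
      (fun T : ℝ => weightedMean σ T
          - 2 / (3 * (1 - 2 * σ)) * (T / (2 * Real.pi)) ^ (1 / 2 : ℝ))
        =O[atTop] (fun T : ℝ => T ^ (1 / 4 : ℝ))) ∧
    (1 / 4 < σ → σ < 1 / 2 →
      (fun T : ℝ => weightedMean σ T
          - (2 / (3 * (1 - 2 * σ)) * (T / (2 * Real.pi)) ^ (1 / 2 : ℝ)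
            + (riemannZeta (2 * (σ : ℂ))).re / (σ + 1) * (T / (2 * Real.pi)) ^ σ))
        =O[atTop] (fun T : ℝ => T ^ (1 / 4 : ℝ))) ∧
    (σ = 1 / 2 →
      (fun T : ℝ => weightedMean σ T
          - (1 / 3 * (T / (2 * Real.pi)) ^ (1 / 2 : ℝ) * Real.log (T / (2 * Real.pi))
            + 2 * ((3 * Real.eulerMascheroniConstant - 1) / 9)
              * (T / (2 * Real.pi)) ^ (1 / 2 : ℝ)))
        =O[atTop] (fun T : ℝ => T ^ (1 / 4 : ℝ) * Real.sqrt (Real.log T))) ∧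
    (1 / 2 < σ → σ < 1 →
      (fun T : ℝ => weightedMean σ T
          - ((riemannZeta (2 * (σ : ℂ))).re / (σ + 1) * (T / (2 * Real.pi)) ^ σ
            + 2 / (3 * (1 - 2 * σ)) * (T / (2 * Real.pi)) ^ (1 / 2 : ℝ)))
        =O[atTop] (fun T : ℝ => T ^ (σ / 2))) ∧
    (1 ≤ σ → σ ≤ 2 →
      (fun T : ℝ => weightedMean σ T
          - (riemannZeta (2 * (σ : ℂ))).re / (σ + 1) * (T / (2 * Real.pi)) ^ σ)
        =O[atTop] (fun T : ℝ => T ^ (σ / 2))) ∧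
    (2 < σ →
      (fun T : ℝ => weightedMean σ T
          - (riemannZeta (2 * (σ : ℂ))).re / (σ + 1) * (T / (2 * Real.pi)) ^ σ)
        =O[atTop] (fun T : ℝ => T ^ (σ - 1))) := by
  refine ⟨fun h => ?_, fun h1 h2 => ?_, fun h => ?_, fun h1 h2 => ?_, fun h1 h2 => ?_, fun h => ?_⟩
  -- This κ makes σ - 1 + κ/2 exactly 1/4. The zeta term is O(T^σ) with σ ≤ 1/4 and joins the error,
  -- which also covers σ = 0 with its arbitrary c.
  · obtain ⟨c, _, hO⟩ := exists_isBigO_weightedMean_sub_rpow (κ := 5 / 2 - 2 * σ) (q := 1 / 4) hσ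
      (fun h0 => by linarith) (by linarith) (by linarith) (by linarith) (by norm_num) (by linarith)
      (by linarith)
    refine (hO.add ((isBigO_div_two_pi_rpow hσ h).const_mul_left (c / (σ + 1)))).congr_left
      fun T => ?_
    ring
  · obtain ⟨c, hc, hO⟩ := exists_isBigO_weightedMean_sub_rpow (κ := 5 / 2 - 2 * σ) (q := 1 / 4) hσ
      (fun h0 => by linarith) (by linarith) (by linarith) (by linarith) (by norm_num) (by linarith)
      (by linarith)
    rw [hc (by linarith)] at hO
    refine hO.congr_left fun T => ?_
    ring
  · subst h
    exact isBigO_weightedMean_half_sub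
  -- κ = 2 - σ makes the off-diagonal exponent σ - 1 + κ/2 equal to σ/2; it is admissible because σ
  -- ≥ 1/2.
  · obtain ⟨c, hc, hO⟩ := exists_isBigO_weightedMean_sub_rpow (κ := 2 - σ) (q := σ / 2) hσ
      (fun h0 => by linarith) (by linarith) (by linarith) (by linarith) (by linarith) (by linarith)
      (by linarith)
    rw [hc (by linarith)] at hO
    exact hO
  · obtain ⟨c, hc, hO⟩ := exists_isBigO_weightedMean_sub_rpow (κ := 2 - σ) (q := σ / 2) hσ
      (fun h0 => by linarith) (by linarith) (by linarith) (by linarith) (by linarith) (by linarith)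
      (by linarith)
    rw [hc (by linarith)] at hO
    -- From σ = 1 on, the term of order T^{1/2} is within O(T^{σ/2}).
    refine (hO.add ((isBigO_div_two_pi_rpow (p := 1 / 2) (q := σ / 2) (by norm_num)
      (by linarith)).const_mul_left (2 / (3 * (1 - 2 * σ))))).congr_left fun T => ?_
    ring
  -- For σ > 2 the choice 2 - σ would be negative; κ = 0 gives the exponent σ - 1, which exceeds
  -- σ/2.
  · obtain ⟨c, hc, hO⟩ := exists_isBigO_weightedMean_sub_rpow (κ := 0) (q := σ - 1) hσ
      (fun h0 => by linarith) le_rfl (by linarith) (by linarith) (by linarith) (by linarith)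
      (by linarith)
    rw [hc (by linarith)] at hO
    refine (hO.add ((isBigO_div_two_pi_rpow (p := 1 / 2) (q := σ - 1) (by norm_num)
      (by linarith)).const_mul_left (2 / (3 * (1 - 2 * σ))))).congr_left fun T => ?_
    ring
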